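/- \textbf{Setting.} Let $n\ge 2$, let $\xi$ have law $\mathcal P$, let $f(\cdot;\xi):\mathbb R^n\to\mathbb R$ be twice differentiable for every $\xi$ (and $f$ jointly measurable, $f(x;\cdot)$ integrable for every $x$), and let $F(x)=\mathbb E_\xi[f(x;\xi)]$ be bounded below, $F^*=\inf F$, $\Delta_F=F(x_0)-F^*$. Norms are Euclidean for vectors and spectral for matrices. Assume, for constants $L_0,M_0,\delta,C_0,C_1>0$ and $L_1,M_1,G_0,G_1,K_0,K_1\ge 0$: (1) $F$ is differentiable and $\|\nabla F(x)-\nabla F(x')\|\le (L_0+L_1\|\nabla F(x)\|)\|x-x'\|$ whenever $L_1\|x-x'\|\le 1$; (2) $\mathbb E_\xi[\nabla f(x;\xi)]=\nabla F(x)$ and $\mathbb E_\xi\|\nabla f(x;\xi)-\nabla F(x)\|^2\le G_0^2+G_1^2\|\nabla F(x)\|^2$ for all $x$; (3) $F$ is twice differentiable, $\|\nabla^2F(x)-\nabla^2F(x')\|\le (M_0+M_1\|\nabla F(x)\|)\|x-x'\|$ whenever $\|x-x'\|\le\delta$, $\mathbb E_\xi[\nabla^2 f(x;\xi)]=\nabla^2F(x)$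 and $\mathbb E_\xi\|\nabla^2 f(x;\xi)-\nabla^2F(x)\|^2\le K_0^2+K_1^2\|\nabla F(x)\|^2$ for all $x$. \textbf{Method.} Starting from a fixed point $x_0$, for $t=0,\dots,T-1$: draw independent samples from $\mathcal P$, independent of everything before iteration $t$, forming batches $\mathcal S_1,\mathcal S_2$; put $g_t=\nabla f(x_t;\mathcal S_1)$, $H_t=\nabla^2 f(x_t;\mathcal S_2)$, where $f(x;\mathcal S)=|\mathcal S|^{-1}\sum_{\xi\in\mathcal S}f(x;\xi)$; choose a (possibly random) $V_t\in\mathbb R^{n\times k}$ with $V_t^TV_t=I$; put $B_t=V_tV_t^TH_tV_tV_t^T$; let $d_{t+1}$ be a global minimizer of $F(x_t)+g_t^Td+\frac12 d^TB_td$ over $\|d\|\le\sqrt\epsilon$; set $x_{t+1}=x_t+d_{t+1}$. Assume (4) almost surely, for all $t<T$, $\|(\nabla^2F(x_t)-V_tV_t^T\nabla^2F(x_t)V_tV_t^T)d_{t+1}\|\le (C_0+C_1\|\nabla F(x_t)\|)\|d_{t+1}\|^2$. \textbf{Theorem.} For all $D\in\mathbb R$ and $0<a\le b$ there is a constant $C>0$,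 depending only on $L_0,L_1,G_0,G_1,\delta,M_0,M_1,K_0,K_1,C_0,C_1,D,a,b$, such that the following holds for every problem and every run as above with $\Delta_F\le D$. If $$0<\epsilon<\min\Big\{\frac{3}{5M_1+18G_1+24K_1+6C_1},\ \frac1{L_1^2}\Big\}$$ (with $1/L_1^2=\infty$ if $L_1=0$), $|\mathcal S_1|=\lceil\epsilon^{-2}\rceil$, $|\mathcal S_2|=\lceil 22\log(n)\,\epsilon^{-1}\rceil$ and $a\,\epsilon^{-3/2}\le T\le b\,\epsilon^{-3/2}$, and if $\bar t$ is uniform on $\{0,\dots,T-1\}$ and independent of the run, then $$\mathbb E\big[\|\nabla F(x_{\bar t+1})\|\big]\le C\epsilon,\qquad \mathbb E\big[\lambda_{\min}\big(V_{\bar t}V_{\bar t}^T\,\nabla^2F(x_{\bar t+1})\,V_{\bar t}V_{\bar t}^T\big)\big]\ge -C\sqrt\epsilon ,$$ both expectations being well defined and finite. -/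

import Mathlib

open MeasureTheory ProbabilityTheory

noncomputable section

namespace TrustRegion

/-- `ℝⁿ` with the Euclidean norm. -/
abbrev Vec (n : ℕ) : Type := EuclideanSpace ℝ (Fin n)

variable {n k : ℕ} {Ξ Ω : Type*}

/-- The Hessian `∇²F(x)`, as a linear operator on `ℝⁿ`; its operator norm is the spectral norm. -/
def hess (F : Vec n → ℝ) (x : Vec n) : Vec n →L[ℝ] Vec n :=
  fderiv ℝ (gradient F) x

/-- Smallest eigenvalue of a symmetric operator. -/
def lambdaMin (A : Vec n →L[ℝ] Vec n) : ℝ := sInf (spectrum ℝ A)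

/-- The function is twice differentiable on `ℝⁿ`. -/
def TwiceDifferentiable (F : Vec n → ℝ) : Prop :=
  Differentiable ℝ F ∧ Differentiable ℝ (gradient F)

/-- The objective `F(x) = E_ξ f(x; ξ)`. -/
def objective [MeasurableSpace Ξ] (P : Measure Ξ) (f : Vec n → Ξ → ℝ) (x : Vec n) : ℝ :=
  ∫ ξ, f x ξ ∂P

/-- `(L₀, L₁)`-smoothness. The condition `‖x - x'‖ ≤ 1 / L₁` is void for `L₁ = 0`. -/
def GeneralizedSmooth (F : Vec n → ℝ) (L₀ L₁ : ℝ) : Prop :=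
  Differentiable ℝ F ∧ ∀ x x' : Vec n, L₁ * ‖x - x'‖ ≤ 1 →
    ‖gradient F x - gradient F x'‖ ≤ (L₀ + L₁ * ‖gradient F x‖) * ‖x - x'‖

/-- The stochastic gradient is unbiased with `(G₀, G₁)`-bounded variance. -/
def BoundedGradientVariance [MeasurableSpace Ξ] (P : Measure Ξ) (f : Vec n → Ξ → ℝ)
    (G₀ G₁ : ℝ) : Prop :=
  ∀ x : Vec n,
    Integrable (fun ξ => gradient (fun y => f y ξ) x) P ∧
    ∫ ξ, gradient (fun y => f y ξ) x ∂P = gradient (objective P f) x ∧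
    Integrable (fun ξ => ‖gradient (fun y => f y ξ) x - gradient (objective P f) x‖ ^ 2) P ∧
    ∫ ξ, ‖gradient (fun y => f y ξ) x - gradient (objective P f) x‖ ^ 2 ∂P
      ≤ G₀ ^ 2 + G₁ ^ 2 * ‖gradient (objective P f) x‖ ^ 2

/-- Second-order generalized smoothness. -/
def SecondOrderSmooth (F : Vec n → ℝ) (δ M₀ M₁ : ℝ) : Prop :=
  TwiceDifferentiable F ∧ ∀ x x' : Vec n, ‖x - x'‖ ≤ δ →
    ‖hess F x - hess F x'‖ ≤ (M₀ + M₁ * ‖gradient F x‖) * ‖x - x'‖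

/-- The stochastic Hessian is unbiased with `(K₀, K₁)`-bounded variance. -/
def BoundedHessianVariance [MeasurableSpace Ξ] (P : Measure Ξ) (f : Vec n → Ξ → ℝ)
    (K₀ K₁ : ℝ) : Prop :=
  ∀ x : Vec n,
    Integrable (fun ξ => hess (fun y => f y ξ) x) P ∧
    ∫ ξ, hess (fun y => f y ξ) x ∂P = hess (objective P f) x ∧
    Integrable (fun ξ => ‖hess (fun y => f y ξ) x - hess (objective P f) x‖ ^ 2) P ∧
    ∫ ξ, ‖hess (fun y => f y ξ) x - hess (objective P f) x‖ ^ 2 ∂P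
      ≤ K₀ ^ 2 + K₁ ^ 2 * ‖gradient (objective P f) x‖ ^ 2

/-- The batch function `f(x; S) = |S|⁻¹ ∑_{ξ ∈ S} f(x; ξ)` of a batch `S` of `m` samples. -/
def batch {m : ℕ} (f : Vec n → Ξ → ℝ) (S : Fin m → Ξ) (x : Vec n) : ℝ :=
  (m : ℝ)⁻¹ * ∑ i, f x (S i)

/-- The operator `V Vᵀ`. -/
def proj (V : Matrix (Fin n) (Fin k) ℝ) : Vec n →L[ℝ] Vec n :=
  Matrix.toEuclideanCLM (𝕜 := ℝ) (V * V.transpose)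

/-- The projected operator `V Vᵀ A V Vᵀ`. -/
def projected (V : Matrix (Fin n) (Fin k) ℝ) (A : Vec n →L[ℝ] Vec n) : Vec n →L[ℝ] Vec n :=
  proj V ∘L A ∘L proj V

/-- The quadratic model `c + gᵀ d + dᵀ B d / 2`. -/
def model (c : ℝ) (g : Vec n) (B : Vec n →L[ℝ] Vec n) (d : Vec n) : ℝ :=
  c + inner ℝ g d + (1 / 2) * inner ℝ d (B d)

/-- `d` is a global solution of the trust region subproblem: it minimizes the model over
`‖d‖ ≤ Δ`. -/
def SolvesSubproblem (c : ℝ) (g : Vec n) (B : Vec n →L[ℝ] Vec n) (Δ : ℝ) (d : Vec n) : Prop :=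
  ‖d‖ ≤ Δ ∧ ∀ e : Vec n, ‖e‖ ≤ Δ → model c g B d ≤ model c g B e

/-- A run of `T` iterations of the trust region method with projected Hessian estimates, started
at `x₀`, with constant radius `Δ` and batch sizes `m₁`, `m₂`. Here `x t` is the iterate, `d (t + 1)`
the step, `S₁ t` and `S₂ t` the batches and `V t` the basis matrix of iteration `t`; `ℱ t` carries
the randomness before iteration `t`. The basis `V t` may depend on everything known by
the end of iteration `t`, and on extra randomness. -/
structure IsRun [MeasurableSpace Ξ] [mΩ : MeasurableSpace Ω] (P : Measure Ξ) (f : Vec n → Ξ → ℝ)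
    (μ : Measure Ω) (ℱ : Filtration ℕ mΩ) (x₀ : Vec n) (Δ : ℝ) (T m₁ m₂ : ℕ)
    (S₁ : ℕ → Fin m₁ → Ω → Ξ) (S₂ : ℕ → Fin m₂ → Ω → Ξ)
    (V : ℕ → Ω → Matrix (Fin n) (Fin k) ℝ) (x d : ℕ → Ω → Vec n) : Prop where
  /-- the run starts at `x₀` -/
  start : ∀ ω, x 0 ω = x₀
  /-- the iterates, samples and bases are part of the history -/
  iterate_meas : ∀ t ≤ T, Measurable[ℱ t] (x t)
  sample₁_meas : ∀ t < T, ∀ i, Measurable[ℱ (t + 1)] (S₁ t i)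
  sample₂_meas : ∀ t < T, ∀ j, Measurable[ℱ (t + 1)] (S₂ t j)
  basis_meas : ∀ t < T, ∀ i j, Measurable[ℱ (t + 1)] (fun ω => V t ω i j)
  /-- the samples have law `P` -/
  sample₁_law : ∀ t < T, ∀ i, μ.map (S₁ t i) = P
  sample₂_law : ∀ t < T, ∀ j, μ.map (S₂ t j) = P
  /-- the samples of one iteration are mutually independent -/
  sample_indep : ∀ t < T,
    iIndepFun (β := fun _ : Fin m₁ ⊕ Fin m₂ => Ξ) (fun i => Sum.elim (S₁ t) (S₂ t) i) μ
  /-- the samples of iteration `t` are jointly independent of everything before -/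
  sample_fresh : ∀ t < T,
    Indep (MeasurableSpace.comap
      (fun ω => ((fun i => S₁ t i ω, fun j => S₂ t j ω) : (Fin m₁ → Ξ) × (Fin m₂ → Ξ)))
      inferInstance) (ℱ t) μ
  /-- the columns of `V t` are orthonormal -/
  basis_orthonormal : ∀ t < T, ∀ ω, (V t ω).transpose * V t ω = 1
  /-- the step solves the subproblem with `g_t = ∇f(x_t; S₁)` and
  `B_t = V_t V_tᵀ H_t V_t V_tᵀ`, where `H_t = ∇²f(x_t; S₂)` -/
  step : ∀ t < T, ∀ ω,
    SolvesSubproblem (objective P f (x t ω))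
      (gradient (batch f (fun i => S₁ t i ω)) (x t ω))
      (projected (V t ω) (hess (batch f (fun j => S₂ t j ω)) (x t ω)))
      Δ (d (t + 1) ω)
  update : ∀ t < T, ∀ ω, x (t + 1) ω = x t ω + d (t + 1) ω

/-- The inexactness condition on the subspaces: almost surely, for every `t < T`,
`‖(∇²F(x_t) - V_t V_tᵀ ∇²F(x_t) V_t V_tᵀ) d_{t+1}‖ ≤ (C₀ + C₁ ‖∇F(x_t)‖) ‖d_{t+1}‖²`. -/
def SubspaceInexactness [MeasurableSpace Ω] (F : Vec n → ℝ) (μ : Measure Ω) (T : ℕ)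
    (V : ℕ → Ω → Matrix (Fin n) (Fin k) ℝ) (x d : ℕ → Ω → Vec n) (C₀ C₁ : ℝ) : Prop :=
  ∀ t < T, ∀ᵐ ω ∂μ,
    ‖(hess F (x t ω) - projected (V t ω) (hess F (x t ω))) (d (t + 1) ω)‖
      ≤ (C₀ + C₁ * ‖gradient F (x t ω)‖) * ‖d (t + 1) ω‖ ^ 2

/-- Joint law of an index `t̄` uniform on `{0, …, T - 1}` and, independently of it, the run. -/
def withUniformIndex [MeasurableSpace Ω] (T : ℕ) (μ : Measure Ω) : Measure (ℕ × Ω) :=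
  (uniformOn (Set.Iio T)).prod μ

end TrustRegion

end

/-!
The solution of a trust region subproblem satisfies `g + B d = -θ d` with a multiplier `θ ≥ 0` that
vanishes off the boundary and bounds the negative curvature of `B`. Comparing `F` with the model
along `d`, every iteration decreases `F` by at least `Δ / 2 * ‖∇F‖` and by at least
`Δ ^ 2 / 2 * -λ_min` at the new iterate, up to an error of order `Δ ^ 3` when the gradient estimate
is accurate to `Δ ^ 2` and the Hessian estimate to `Δ`.

The spectral norm is not smooth, but its square is dominated by the square of a Schatten norm of
order about `2 * log n`, which has a quadratic majorant with a constant of order `log n`. Adding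
independent centered samples one at a time therefore costs only a factor `log n` in the expected
squared norm of their sum, and a batch of order `log n / Δ ^ 2` suffices for the Hessian.

Telescoping and averaging over `T ~ Δ⁻³` iterations gives the rates. The part of the step errors
that grows with the gradient is absorbed by the decrease once `Δ` is below a threshold; above the
threshold there are boundedly many iterations, each at most doubling the gradient up to a constant,
so that crude bounds suffice.
-/

noncomputable section

namespace TrustRegion

section RealCalculus

theorem hasDerivAt_add_smul {E : Type*} [NormedAddCommGroup E] [NormedSpace ℝ E] (A X : E) (s : ℝ) :
    HasDerivAt (fun s : ℝ => A + s • X) X s := by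
  simpa using ((hasDerivAt_id s).smul_const X).const_add A

theorem le_of_hasDerivAt_le {f g f' g' : ℝ → ℝ} (hf : ∀ s, HasDerivAt f (f' s) s)
    (hg : ∀ s, HasDerivAt g (g' s) s) (h₀ : f 0 ≤ g 0) {s : ℝ} (hs : 0 ≤ s)
    (h : ∀ r ∈ Set.Ico 0 s, f' r ≤ g' r) : f s ≤ g s :=
  image_le_of_deriv_right_le_deriv_boundary
    (fun r _ => (hf r).continuousAt.continuousWithinAt) (fun r _ => (hf r).hasDerivWithinAt) h₀
    (fun r _ => (hg r).continuousAt.continuousWithinAt) (fun r _ => (hg r).hasDerivWithinAt) h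
    (Set.right_mem_Icc.2 hs)

theorem le_add_of_deriv2_le {g g₁ g₂ : ℝ → ℝ} {K : ℝ} (h₁ : ∀ s, HasDerivAt g (g₁ s) s)
    (h₂ : ∀ s, HasDerivAt g₁ (g₂ s) s) (hK : ∀ s, g₂ s ≤ 2 * K) : g 1 ≤ g 0 + g₁ 0 + K := by
  have deriv_le : ∀ s, 0 ≤ s → g₁ s ≤ g₁ 0 + 2 * K * s := fun s hs =>
    le_of_hasDerivAt_le (g := fun r => g₁ 0 + 2 * K * r) (g' := fun _ => 2 * K) h₂
      (fun r => by simpa using ((hasDerivAt_id r).const_mul (2 * K)).const_add (g₁ 0))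
      (by simp) hs fun r _ => hK r
  have hquad : ∀ r, HasDerivAt (fun r => g 0 + g₁ 0 * r + K * r ^ 2) (g₁ 0 + 2 * K * r) r :=
    fun r => ((((hasDerivAt_id r).const_mul (g₁ 0)).const_add (g 0)).add
      ((hasDerivAt_pow 2 r).const_mul K)).congr_deriv (by simp; ring)
  simpa using le_of_hasDerivAt_le h₁ hquad (by simp) zero_le_one fun r hr => deriv_le r hr.1

theorem rpow_le_add_of_deriv2_le {h h₁ h₂ : ℝ → ℝ} {q R : ℝ} (hq₀ : 0 < q) (hq₁ : q ≤ 1)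
    (hpos : ∀ s, 0 < h s) (hh : ∀ s, HasDerivAt h (h₁ s) s) (hh₁ : ∀ s, HasDerivAt h₁ (h₂ s) s)
    (hR : ∀ s, h₂ s ≤ 2 * q⁻¹ * R * h s ^ (1 - q)) :
    h 1 ^ q ≤ h 0 ^ q + q * h 0 ^ (q - 1) * h₁ 0 + R := by
  have deriv1 : ∀ s, HasDerivAt (fun s => h s ^ q) (q * h s ^ (q - 1) * h₁ s) s := fun s =>
    ((hh s).rpow_const (p := q) (Or.inl (hpos s).ne')).congr_deriv (by ring)
  have deriv2 : ∀ s, HasDerivAt (fun s => q * h s ^ (q - 1) * h₁ s)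
      (-(q * (1 - q) * (h s ^ (q - 2) * h₁ s ^ 2)) + q * h s ^ (q - 1) * h₂ s) s := fun s => by
    refine ((((hh s).rpow_const (p := q - 1) (Or.inl (hpos s).ne')).const_mul q).mul
      (hh₁ s)).congr_deriv ?_
    rw [show q - 1 - 1 = q - 2 by ring]
    ring
  refine le_add_of_deriv2_le deriv1 deriv2 fun s => ?_
  -- The term in `h₁ ^ 2` is nonpositive because `t ↦ t ^ q` is concave.
  have concave_term : 0 ≤ q * (1 - q) * (h s ^ (q - 2) * h₁ s ^ 2) :=
    mul_nonneg (mul_nonneg hq₀.le (sub_nonneg.2 hq₁))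
      (mul_nonneg (Real.rpow_nonneg (hpos s).le _) (sq_nonneg _))
  have hcancel : h s ^ (q - 1) * h s ^ (1 - q) = 1 := by
    rw [← Real.rpow_add (hpos s)]
    simp
  have main_term : q * h s ^ (q - 1) * h₂ s ≤ 2 * R :=
    calc q * h s ^ (q - 1) * h₂ s
        ≤ q * h s ^ (q - 1) * (2 * q⁻¹ * R * h s ^ (1 - q)) :=
          mul_le_mul_of_nonneg_left (hR s) (mul_nonneg hq₀.le (Real.rpow_nonneg (hpos s).le _))
      _ = q * q⁻¹ * (h s ^ (q - 1) * h s ^ (1 - q)) * (2 * R) := by ring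
      _ = 2 * R := by rw [hcancel, mul_inv_cancel₀ hq₀.ne', one_mul, one_mul]
  linarith

end RealCalculus

section FiniteSums

variable {ι : Type*} [Fintype ι]

theorem pow_mul_pow_add_pow_mul_pow_le {j k r : ℕ} (hjk : j + k = 2 * r) (x y : ℝ) :
    x ^ j * y ^ k + y ^ j * x ^ k ≤ x ^ (2 * r) + y ^ (2 * r) := by
  have hmono : 0 ≤ (|y| ^ j - |x| ^ j) * (|y| ^ k - |x| ^ k) :=
    (((pow_left_monotoneOn (n := j)).monovaryOn pow_left_monotoneOn).sub_mul_sub_nonneg)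
      (abs_nonneg x) (abs_nonneg y)
  have habs : ∀ u w : ℝ, u ^ j * w ^ k ≤ |u| ^ j * |w| ^ k := fun u w => by
    rw [← abs_pow, ← abs_pow, ← abs_mul]
    exact le_abs_self _
  have hsplit : ∀ u : ℝ, u ^ (2 * r) = |u| ^ j * |u| ^ k := fun u => by
    rw [← pow_add, hjk, pow_mul, pow_mul, sq_abs]
  rw [hsplit, hsplit]
  linarith [habs x y, habs y x]

theorem sum_sum_pow_mul_pow_mul_le {j k r : ℕ} (hjk : j + k = 2 * r) (l : ι → ℝ)
    {w : ι → ι → ℝ} (hw : ∀ a c, 0 ≤ w a c) (hsymm : ∀ a c, w a c = w c a) :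
    ∑ a, ∑ c, l a ^ j * l c ^ k * w a c ≤ ∑ a, l a ^ (2 * r) * ∑ c, w a c := by
  have hswap : ∀ u : ι → ι → ℝ, ∑ a, ∑ c, u c a * w a c = ∑ a, ∑ c, u a c * w a c := fun u => by
    rw [Finset.sum_comm]
    simp only [hsymm]
  have hsum : ∑ a, ∑ c, (l a ^ j * l c ^ k + l c ^ j * l a ^ k) * w a c
      ≤ ∑ a, ∑ c, (l a ^ (2 * r) + l c ^ (2 * r)) * w a c :=
    Finset.sum_le_sum fun a _ => Finset.sum_le_sum fun c _ =>
      mul_le_mul_of_nonneg_right (pow_mul_pow_add_pow_mul_pow_le hjk _ _) (hw a c)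
  simp only [add_mul, Finset.sum_add_distrib] at hsum
  rw [hswap fun a c => l a ^ j * l c ^ k, hswap fun a _ => l a ^ (2 * r)] at hsum
  simp only [Finset.mul_sum]
  linarith

theorem sum_pow_le_card_rpow_mul_sum_pow_succ_rpow {u : ι → ℝ} (hu : ∀ i, 0 ≤ u i) {p : ℕ}
    (hp : 1 ≤ p) :
    ∑ i, u i ^ p ≤ (Fintype.card ι : ℝ) ^ (1 / ((p : ℝ) + 1))
      * (∑ i, u i ^ (p + 1)) ^ (1 - 1 / ((p : ℝ) + 1)) := by
  have hp₀ : (0 : ℝ) < p := by exact_mod_cast hp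
  have hconj : ((p : ℝ) + 1).HolderConjugate (((p : ℝ) + 1) / p) := by
    rw [Real.holderConjugate_iff]
    exact ⟨by linarith, by field_simp; ring⟩
  have holder := Real.inner_le_Lp_mul_Lq_of_nonneg Finset.univ (f := fun _ => (1 : ℝ))
    (g := fun i => u i ^ p) hconj (fun _ _ => zero_le_one) (fun i _ => pow_nonneg (hu i) _)
  have hpow : ∀ i, (u i ^ p) ^ (((p : ℝ) + 1) / p) = u i ^ (p + 1) := fun i => by
    rw [← Real.rpow_natCast, ← Real.rpow_mul (hu i), mul_div_cancel₀ _ hp₀.ne']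
    exact_mod_cast Real.rpow_natCast (u i) (p + 1)
  have hexp : 1 / (((p : ℝ) + 1) / p) = 1 - 1 / ((p : ℝ) + 1) := by
    field_simp
    ring
  simpa only [one_mul, Real.one_rpow, Finset.sum_const, Finset.card_univ, nsmul_eq_mul, mul_one,
    hpow, hexp] using holder

end FiniteSums

section Eigenbasis

variable {E : Type*} [NormedAddCommGroup E] [InnerProductSpace ℝ E]
  {ι : Type*} [Fintype ι] {b : OrthonormalBasis ι ℝ E} {A : E →L[ℝ] E} {l : ι → ℝ}

theorem pow_apply_eigenbasis (hb : ∀ i, A (b i) = l i • b i) (j : ℕ) (i : ι) :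
    (A ^ j) (b i) = l i ^ j • b i := by
  induction j with
  | zero => simp
  | succ j ih => rw [pow_succ, mul_apply_eq_comp, hb, map_smul, ih, smul_smul, pow_succ']

theorem inner_eigenbasis_apply (hb : ∀ i, A (b i) = l i • b i) (i : ι) (v : E) :
    inner ℝ (b i) (A v) = l i * inner ℝ (b i) v := by
  classical
  conv_lhs => rw [← b.sum_repr' v]
  simp only [map_sum, map_smul, hb, smul_smul, inner_sum, inner_smul_right,
    b.inner_eq_ite, mul_ite, mul_one, mul_zero, Finset.sum_ite_eq, Finset.mem_univ, if_true]
  ring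

theorem opNorm_le_of_abs_eigenvalue_le (hb : ∀ i, A (b i) = l i • b i) {R : ℝ} (hR : 0 ≤ R)
    (hl : ∀ i, |l i| ≤ R) : ‖A‖ ≤ R := by
  refine A.opNorm_le_bound hR fun v => le_of_sq_le_sq ?_ (by positivity)
  rw [mul_pow, ← b.sum_sq_norm_inner_right, ← b.sum_sq_norm_inner_right v, Finset.mul_sum]
  refine Finset.sum_le_sum fun i _ => ?_
  rw [inner_eigenbasis_apply hb, norm_mul, mul_pow, Real.norm_eq_abs]
  gcongr
  exact hl i

end Eigenbasis

section TracePotential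

variable {E : Type*} [NormedAddCommGroup E] [InnerProductSpace ℝ E] [FiniteDimensional ℝ E]

/-- The trace of an operator, as a continuous linear functional. -/
def opTrace (E : Type*) [NormedAddCommGroup E] [InnerProductSpace ℝ E]
    [FiniteDimensional ℝ E] : (E →L[ℝ] E) →L[ℝ] ℝ :=
  LinearMap.toContinuousLinearMap (LinearMap.trace ℝ E ∘ₗ ContinuousLinearMap.coeLM ℝ)

theorem opTrace_mul_comm (A B : E →L[ℝ] E) : opTrace E (A * B) = opTrace E (B * A) :=
  LinearMap.trace_mul_comm ℝ (A : E →ₗ[ℝ] E) (B : E →ₗ[ℝ] E)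

variable {ι : Type*} [Fintype ι] (b : OrthonormalBasis ι ℝ E)

theorem opTrace_eq_sum_inner (A : E →L[ℝ] E) : opTrace E A = ∑ i, inner ℝ (b i) (A (b i)) :=
  LinearMap.trace_eq_sum_inner (A : E →ₗ[ℝ] E) b

theorem exists_eigenbasis {A : E →L[ℝ] E} (hA : IsSelfAdjoint A) :
    ∃ (b : OrthonormalBasis (Fin (Module.finrank ℝ E)) ℝ E) (l : Fin (Module.finrank ℝ E) → ℝ),
      ∀ i, A (b i) = l i • b i :=
  have hs := ContinuousLinearMap.isSelfAdjoint_iff_isSymmetric.1 hA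
  ⟨hs.eigenvectorBasis rfl, hs.eigenvalues rfl, hs.apply_eigenvectorBasis rfl⟩

variable {b} {A X : E →L[ℝ] E} {l : ι → ℝ}

theorem opTrace_pow_eq_sum (hb : ∀ i, A (b i) = l i • b i) (j : ℕ) :
    opTrace E (A ^ j) = ∑ i, l i ^ j := by
  simp only [opTrace_eq_sum_inner b, pow_apply_eigenbasis hb, inner_smul_right,
    real_inner_self_eq_norm_sq, b.norm_eq_one, one_pow, mul_one]

theorem opTrace_pow_mul_pow_mul_eq_sum (hb : ∀ i, A (b i) = l i • b i) (hX : IsSelfAdjoint X)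
    (j k : ℕ) : opTrace E (A ^ j * X * A ^ k * X)
      = ∑ a, ∑ c, l a ^ j * l c ^ k * inner ℝ (b c) (X (b a)) ^ 2 := by
  have hXs := ContinuousLinearMap.isSelfAdjoint_iff_isSymmetric.1 hX
  rw [opTrace_eq_sum_inner b]
  refine Finset.sum_congr rfl fun a _ => ?_
  have hmove : inner ℝ (b a) ((A ^ j * X * A ^ k * X) (b a))
      = l a ^ j * inner ℝ (X (b a)) ((A ^ k) (X (b a))) := by
    simp only [mul_apply_eq_comp]
    rw [inner_eigenbasis_apply (pow_apply_eigenbasis hb j)]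
    exact congrArg (l a ^ j * ·) (hXs _ _).symm
  rw [hmove, ← b.sum_inner_mul_inner, Finset.mul_sum]
  refine Finset.sum_congr rfl fun c _ => ?_
  rw [inner_eigenbasis_apply (pow_apply_eigenbasis hb k), real_inner_comm (b c)]
  ring

theorem opTrace_pow_mul_pow_mul_le (hA : IsSelfAdjoint A) (hX : IsSelfAdjoint X) {j k r : ℕ}
    (hjk : j + k = 2 * r) :
    opTrace E (A ^ j * X * A ^ k * X) ≤ ‖X‖ ^ 2 * opTrace E (A ^ (2 * r)) := by
  obtain ⟨b, l, hb⟩ := exists_eigenbasis hA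
  have hsymm : ∀ a c, inner ℝ (b c) (X (b a)) ^ 2 = inner ℝ (b a) (X (b c)) ^ 2 := fun a c => by
    rw [real_inner_comm]
    exact congrArg (· ^ 2) (ContinuousLinearMap.isSelfAdjoint_iff_isSymmetric.1 hX (b a) (b c))
  have hrow : ∀ a, ∑ c, inner ℝ (b c) (X (b a)) ^ 2 ≤ ‖X‖ ^ 2 := fun a => by
    have hparseval := b.sum_sq_norm_inner_right (X (b a))
    simp only [Real.norm_eq_abs, sq_abs] at hparseval
    rw [hparseval]
    gcongr
    simpa using X.le_opNorm (b a)
  calc opTrace E (A ^ j * X * A ^ k * X)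
      = ∑ a, ∑ c, l a ^ j * l c ^ k * inner ℝ (b c) (X (b a)) ^ 2 :=
        opTrace_pow_mul_pow_mul_eq_sum hb hX j k
    _ ≤ ∑ a, l a ^ (2 * r) * ∑ c, inner ℝ (b c) (X (b a)) ^ 2 :=
        sum_sum_pow_mul_pow_mul_le hjk l (fun _ _ => sq_nonneg _) hsymm
    _ ≤ ∑ a, l a ^ (2 * r) * ‖X‖ ^ 2 :=
        Finset.sum_le_sum fun a _ =>
          mul_le_mul_of_nonneg_left (hrow a) ((even_two_mul r).pow_nonneg _)
    _ = ‖X‖ ^ 2 * opTrace E (A ^ (2 * r)) := by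
        rw [opTrace_pow_eq_sum hb, Finset.mul_sum]
        exact Finset.sum_congr rfl fun a _ => mul_comm _ _

theorem opTrace_pow_two_mul_nonneg (hA : IsSelfAdjoint A) (p : ℕ) :
    0 ≤ opTrace E (A ^ (2 * p)) := by
  obtain ⟨b, l, hb⟩ := exists_eigenbasis hA
  rw [opTrace_pow_eq_sum hb]
  exact Finset.sum_nonneg fun i _ => (even_two_mul p).pow_nonneg _

theorem opNorm_pow_le_opTrace (hA : IsSelfAdjoint A) {p : ℕ} (hp : p ≠ 0) :
    ‖A‖ ^ (2 * p) ≤ opTrace E (A ^ (2 * p)) := by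
  obtain ⟨b, l, hb⟩ := exists_eigenbasis hA
  have htrace := opTrace_pow_two_mul_nonneg hA p
  have hroot := Real.rpow_inv_natCast_pow htrace (n := 2 * p) (by positivity)
  set R := opTrace E (A ^ (2 * p)) ^ ((2 * p : ℕ) : ℝ)⁻¹
  have hR : 0 ≤ R := Real.rpow_nonneg htrace _
  have hl : ∀ i, |l i| ≤ R := fun i => by
    refine le_of_pow_le_pow_left₀ (n := 2 * p) (by positivity) hR ?_
    rw [hroot, (even_two_mul p).pow_abs, opTrace_pow_eq_sum hb]
    exact Finset.single_le_sum (f := fun i => l i ^ (2 * p))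
      (fun i _ => (even_two_mul p).pow_nonneg _) (Finset.mem_univ i)
  rw [← hroot]
  gcongr
  exact opNorm_le_of_abs_eigenvalue_le hb hR hl

theorem opTrace_pow_le_rpow_opTrace_pow (hA : IsSelfAdjoint A) {p : ℕ} (hp : 1 ≤ p) :
    opTrace E (A ^ (2 * p)) ≤ (Module.finrank ℝ E : ℝ) ^ (1 / ((p : ℝ) + 1))
      * opTrace E (A ^ (2 * (p + 1))) ^ (1 - 1 / ((p : ℝ) + 1)) := by
  obtain ⟨b, l, hb⟩ := exists_eigenbasis hA
  rw [opTrace_pow_eq_sum hb, opTrace_pow_eq_sum hb]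
  simpa only [pow_mul, Fintype.card_fin] using
    sum_pow_le_card_rpow_mul_sum_pow_succ_rpow (fun i => sq_nonneg (l i)) hp

theorem hasDerivAt_opTrace_pow (A X : E →L[ℝ] E) (N : ℕ) (s : ℝ) :
    HasDerivAt (fun s : ℝ => opTrace E ((A + s • X) ^ (N + 1)))
      ((N + 1 : ℕ) * opTrace E ((A + s • X) ^ N * X)) s := by
  have hcyclic : ∀ i ∈ Finset.range (N + 1),
      opTrace E ((A + s • X) ^ (N - i) * X * (A + s • X) ^ i)
        = opTrace E ((A + s • X) ^ N * X) := fun i hi => by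
    rw [opTrace_mul_comm, ← mul_assoc, ← pow_add,
      Nat.add_sub_cancel' (Nat.lt_succ_iff.1 (Finset.mem_range.1 hi))]
  refine ((opTrace E).hasFDerivAt.comp_hasDerivAt s
    ((hasDerivAt_add_smul A X s).fun_pow' (N + 1))).congr_deriv ?_
  rw [map_sum]
  exact (Finset.sum_congr rfl hcyclic).trans (by simp)

theorem hasDerivAt_opTrace_pow_mul (A X : E →L[ℝ] E) (N : ℕ) (s : ℝ) :
    HasDerivAt (fun s : ℝ => opTrace E ((A + s • X) ^ (N + 1) * X))
      (∑ i ∈ Finset.range (N + 1),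
        opTrace E ((A + s • X) ^ (N - i) * X * (A + s • X) ^ i * X)) s := by
  refine ((opTrace E).hasFDerivAt.comp_hasDerivAt s
    (((hasDerivAt_add_smul A X s).fun_pow' (N + 1)).mul_const X)).congr_deriv ?_
  rw [Finset.sum_mul, map_sum]
  rfl

theorem sum_opTrace_pow_mul_pow_mul_le (hA : IsSelfAdjoint A) (hX : IsSelfAdjoint X) (p : ℕ) :
    ∑ i ∈ Finset.range (2 * p + 1), opTrace E (A ^ (2 * p - i) * X * A ^ i * X)
      ≤ (2 * p + 1) * ‖X‖ ^ 2 * opTrace E (A ^ (2 * p)) := by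
  have hterm : ∀ i ∈ Finset.range (2 * p + 1),
      opTrace E (A ^ (2 * p - i) * X * A ^ i * X) ≤ ‖X‖ ^ 2 * opTrace E (A ^ (2 * p)) :=
    fun i hi => opTrace_pow_mul_pow_mul_le hA hX
      (Nat.sub_add_cancel (Nat.lt_succ_iff.1 (Finset.mem_range.1 hi)))
  refine (Finset.sum_le_card_nsmul _ _ _ hterm).trans_eq ?_
  rw [Finset.card_range, nsmul_eq_mul]
  push_cast
  ring

theorem sum_opTrace_pow_mul_pow_mul_le_rpow (hA : IsSelfAdjoint A) (hX : IsSelfAdjoint X) {p : ℕ}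
    (hp : 1 ≤ p) {η : ℝ} (hη : 0 ≤ η) :
    ∑ i ∈ Finset.range (2 * p + 1), opTrace E (A ^ (2 * p - i) * X * A ^ i * X)
      ≤ (2 * p + 1) * ‖X‖ ^ 2 * ((Module.finrank ℝ E : ℝ) ^ (1 / ((p : ℝ) + 1)) *
        (opTrace E (A ^ (2 * (p + 1))) + η) ^ (1 - 1 / ((p : ℝ) + 1))) := by
  have hq : 1 / ((p : ℝ) + 1) ≤ 1 := by
    rw [div_le_one (by positivity)]
    linarith [p.cast_nonneg (α := ℝ)]
  refine (sum_opTrace_pow_mul_pow_mul_le hA hX p).trans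
    (mul_le_mul_of_nonneg_left ?_ (by positivity))
  refine (opTrace_pow_le_rpow_opTrace_pow hA hp).trans
    (mul_le_mul_of_nonneg_left ?_ (by positivity))
  exact Real.rpow_le_rpow (opTrace_pow_two_mul_nonneg hA _) (by linarith) (by linarith)

theorem isSelfAdjoint_add_smul (hA : IsSelfAdjoint A) (hX : IsSelfAdjoint X) (s : ℝ) :
    IsSelfAdjoint (A + s • X) :=
  (selfAdjoint.submodule ℝ (E →L[ℝ] E)).add_mem hA (Submodule.smul_mem _ s hX)

/-- The potential `(tr A^{2(p+1)} + τ^{p+1})^{1/(p+1)}`: the square of the Schatten norm of order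
`2(p+1)`, made smooth at the origin by the parameter `τ > 0`. For `p` of the order of the logarithm
of the dimension it is comparable with the square of the operator norm. -/
def tracePotential (p : ℕ) (τ : ℝ) (A : E →L[ℝ] E) : ℝ :=
  (opTrace E (A ^ (2 * (p + 1))) + τ ^ (p + 1)) ^ (1 / ((p : ℝ) + 1))

theorem continuous_tracePotential (p : ℕ) (τ : ℝ) : Continuous (tracePotential (E := E) p τ) :=
  (((opTrace E).continuous.comp (continuous_pow _)).add continuous_const).rpow_const
    fun _ => Or.inr (by positivity)

theorem pow_succ_rpow_one_div {x : ℝ} (hx : 0 ≤ x) (p : ℕ) :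
    (x ^ (p + 1)) ^ (1 / ((p : ℝ) + 1)) = x := by
  simpa using Real.pow_rpow_inv_natCast hx p.succ_ne_zero

theorem tracePotential_zero (p : ℕ) {τ : ℝ} (hτ : 0 ≤ τ) :
    tracePotential p τ (0 : E →L[ℝ] E) = τ := by
  rw [tracePotential, zero_pow (by positivity), map_zero, zero_add, pow_succ_rpow_one_div hτ]

theorem opNorm_sq_le_tracePotential (p : ℕ) {τ : ℝ} (hτ : 0 ≤ τ) (hA : IsSelfAdjoint A) :
    ‖A‖ ^ 2 ≤ tracePotential p τ A := by
  have hnorm := opNorm_pow_le_opTrace hA p.succ_ne_zero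
  rw [← pow_succ_rpow_one_div (sq_nonneg ‖A‖) p, ← pow_mul]
  refine Real.rpow_le_rpow (by positivity) ?_ (by positivity)
  exact hnorm.trans (le_add_of_nonneg_right (pow_nonneg hτ _))

/-- `φ` lies, around each point of `W`, below its value plus a linear functional plus
`L ‖X‖ ^ 2`. This is the only smoothness of a potential that controls the growth of its expectation
along sums of independent centered `W`-valued vectors. -/
def HasQuadraticMajorantOn {E : Type*} [NormedAddCommGroup E] [NormedSpace ℝ E] (φ : E → ℝ)
    (W : AddSubgroup E) (L : ℝ) : Prop :=
  ∀ A ∈ W, ∃ ℓ : E →L[ℝ] ℝ, ∀ X ∈ W, φ (A + X) ≤ φ A + ℓ X + L * ‖X‖ ^ 2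

theorem hasQuadraticMajorantOn_norm_sq {E : Type*} [NormedAddCommGroup E]
    [InnerProductSpace ℝ E] : HasQuadraticMajorantOn (fun x : E => ‖x‖ ^ 2) ⊤ 1 :=
  fun A _ => ⟨(2 : ℝ) • innerSL ℝ A, fun X _ => by
    simp only [smul_apply, innerSL_apply_apply, smul_eq_mul, one_mul, norm_add_sq_real, le_refl]⟩

theorem hasQuadraticMajorantOn_tracePotential {p : ℕ} (hp : 1 ≤ p) {τ : ℝ} (hτ : 0 < τ) :
    HasQuadraticMajorantOn (tracePotential p τ) (selfAdjoint (E →L[ℝ] E))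
      ((2 * p + 1) * (Module.finrank ℝ E : ℝ) ^ (1 / ((p : ℝ) + 1))) := by
  intro A hA
  have hinv : (1 / ((p : ℝ) + 1))⁻¹ = p + 1 := by simp
  have hq₁ : 1 / ((p : ℝ) + 1) ≤ 1 := by
    rw [div_le_one (by positivity)]
    linarith [p.cast_nonneg (α := ℝ)]
  refine ⟨((1 / ((p : ℝ) + 1)) * (opTrace E (A ^ (2 * (p + 1))) + τ ^ (p + 1)) ^
    (1 / ((p : ℝ) + 1) - 1) * (2 * (p + 1))) •
    (opTrace E ∘L ContinuousLinearMap.mul ℝ (E →L[ℝ] E) (A ^ (2 * p + 1))), fun X hX => ?_⟩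
  have hY : ∀ s : ℝ, IsSelfAdjoint (A + s • X) := isSelfAdjoint_add_smul hA hX
  have htrace : ∀ s : ℝ, 0 ≤ opTrace E ((A + s • X) ^ (2 * (p + 1))) := fun s =>
    opTrace_pow_two_mul_nonneg (hY s) _
  have hη : 0 < τ ^ (p + 1) := by positivity
  have deriv1 : ∀ s : ℝ, HasDerivAt
      (fun s : ℝ => opTrace E ((A + s • X) ^ (2 * (p + 1))) + τ ^ (p + 1))
      (2 * (p + 1) * opTrace E ((A + s • X) ^ (2 * p + 1) * X)) s := fun s =>
    ((hasDerivAt_opTrace_pow A X (2 * p + 1) s).add_const _).congr_deriv (by push_cast; ring)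
  have deriv2 := fun s => (hasDerivAt_opTrace_pow_mul A X (2 * p) s).const_mul (2 * ((p : ℝ) + 1))
  have taylor := rpow_le_add_of_deriv2_le (by positivity) hq₁
    (fun s => add_pos_of_nonneg_of_pos (htrace s) hη) deriv1 deriv2
    (R := (2 * p + 1) * (Module.finrank ℝ E : ℝ) ^ (1 / ((p : ℝ) + 1)) * ‖X‖ ^ 2) fun s => ?_
  · simp only [one_smul, zero_smul, add_zero] at taylor
    simp only [tracePotential, smul_apply, ContinuousLinearMap.comp_apply,
      ContinuousLinearMap.mul_apply', smul_eq_mul]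
    linarith
  · rw [hinv]
    calc 2 * ((p : ℝ) + 1) * ∑ i ∈ Finset.range (2 * p + 1),
          opTrace E ((A + s • X) ^ (2 * p - i) * X * (A + s • X) ^ i * X)
        ≤ 2 * (p + 1) * ((2 * p + 1) * ‖X‖ ^ 2 *
          ((Module.finrank ℝ E : ℝ) ^ (1 / ((p : ℝ) + 1)) *
            (opTrace E ((A + s • X) ^ (2 * (p + 1))) + τ ^ (p + 1)) ^ (1 - 1 / ((p : ℝ) + 1)))) :=
          mul_le_mul_of_nonneg_left
            (sum_opTrace_pow_mul_pow_mul_le_rpow (hY s) hX hp hη.le) (by positivity)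
      _ = _ := by ring

end TracePotential

section Sampling

theorem lintegral_pi_succ_sum {E Ξ : Type*} [AddCommMonoid E] [MeasurableSpace E]
    [MeasurableAdd₂ E] [MeasurableSpace Ξ] {P : Measure Ξ} [SigmaFinite P] {Y : Ξ → E}
    (hY : Measurable Y) {ψ : E → ENNReal} (hψ : Measurable ψ) (m : ℕ) :
    ∫⁻ s : Fin (m + 1) → Ξ, ψ (∑ i, Y (s i)) ∂(Measure.pi fun _ => P)
      = ∫⁻ s : Fin m → Ξ, ∫⁻ ξ, ψ (∑ i, Y (s i) + Y ξ) ∂P ∂(Measure.pi fun _ => P) := by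
  have hsum : ∀ m, Measurable fun s : Fin m → Ξ => ∑ i, Y (s i) := fun m =>
    Finset.measurable_sum _ fun i _ => hY.comp (measurable_pi_apply i)
  have hcons : ∀ p : Ξ × (Fin m → Ξ),
      ∑ i, Y ((MeasurableEquiv.piFinSuccAbove (fun _ => Ξ) 0).symm p i)
        = ∑ i, Y (p.2 i) + Y p.1 := fun p => by
    rw [Fin.sum_univ_succ, add_comm]
    rfl
  have hψsum : Measurable fun s : Fin (m + 1) → Ξ => ψ (∑ i, Y (s i)) := hψ.comp (hsum (m + 1))
  have hψadd : Measurable fun p : Ξ × (Fin m → Ξ) => ψ (∑ i, Y (p.2 i) + Y p.1) :=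
    hψ.comp (((hsum m).comp measurable_snd).add (hY.comp measurable_fst))
  rw [← (measurePreserving_piFinSuccAbove (fun _ : Fin (m + 1) => P) 0).symm.lintegral_comp hψsum]
  simp only [hcons]
  exact lintegral_prod_symm' _ hψadd

theorem lintegral_enorm_le_ofReal_sqrt {α E : Type*} [NormedAddCommGroup E] [MeasurableSpace E]
    [BorelSpace E] [SecondCountableTopology E] [MeasurableSpace α] {μ : Measure α}
    [IsProbabilityMeasure μ] {X : α → E} (hX : Measurable X) {w : ℝ}
    (h : ∫⁻ a, ‖X a‖ₑ ^ 2 ∂μ ≤ ENNReal.ofReal w) :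
    ∫⁻ a, ‖X a‖ₑ ∂μ ≤ ENNReal.ofReal (Real.sqrt w) := by
  have jensen := eLpNorm_le_eLpNorm_of_exponent_le (μ := μ) (p := 1) (q := 2) one_le_two
    hX.aestronglyMeasurable
  rw [eLpNorm_one_eq_lintegral_enorm, eLpNorm_eq_lintegral_rpow_enorm_toReal (by norm_num)
    (by norm_num)] at jensen
  refine jensen.trans ?_
  simp only [ENNReal.toReal_ofNat, ENNReal.rpow_ofNat]
  rw [Real.sqrt, ENNReal.ofReal_coe_nnreal, NNReal.sqrt_eq_rpow,
    ENNReal.coe_rpow_of_nonneg _ (by norm_num)]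
  gcongr
  exact h

variable {E Ξ : Type*} [NormedAddCommGroup E] [NormedSpace ℝ E]

/-- The average of `Z` over the samples of the batch `s`. -/
def sampleMean {m : ℕ} (Z : Ξ → E) (s : Fin m → Ξ) : E := (m : ℝ)⁻¹ • ∑ i, Z (s i)

theorem sampleMean_sub {m : ℕ} (hm : 0 < m) (Z : Ξ → E) (z : E) (s : Fin m → Ξ) :
    sampleMean Z s - z = (m : ℝ)⁻¹ • ∑ i, (Z (s i) - z) := by
  have hm₀ : (m : ℝ) ≠ 0 := by exact_mod_cast hm.ne'
  rw [Finset.sum_sub_distrib, smul_sub, Finset.sum_const, Finset.card_univ, Fintype.card_fin,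
    ← Nat.cast_smul_eq_nsmul ℝ, inv_smul_smul₀ hm₀, sampleMean]

variable [MeasurableSpace E] [MeasurableSpace Ξ] {P : Measure Ξ} {Z Y : Ξ → E} {z : E}
  {v : ℝ}

/-- `Z` is a square integrable unbiased estimator of `z` under the law `P`, with variance at
most `v`. -/
structure UnbiasedEstimate (P : Measure Ξ) (Z : Ξ → E) (z : E) (v : ℝ) : Prop where
  measurable : Measurable Z
  integrable : Integrable Z P
  integral_eq : ∫ ξ, Z ξ ∂P = z
  integrable_sq : Integrable (fun ξ => ‖Z ξ - z‖ ^ 2) P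
  integral_sq_le : ∫ ξ, ‖Z ξ - z‖ ^ 2 ∂P ≤ v

theorem UnbiasedEstimate.variance_nonneg (h : UnbiasedEstimate P Z z v) : 0 ≤ v :=
  (integral_nonneg fun _ => by positivity).trans h.integral_sq_le

variable [CompleteSpace E] [IsProbabilityMeasure P]

theorem UnbiasedEstimate.sub_const [BorelSpace E] [SecondCountableTopology E]
    (h : UnbiasedEstimate P Z z v) :
    UnbiasedEstimate P (fun ξ => Z ξ - z) 0 v where
  measurable := h.measurable.sub_const z
  integrable := h.integrable.sub (integrable_const z)
  integral_eq := by simp [integral_sub h.integrable (integrable_const z), h.integral_eq]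
  integrable_sq := by simpa only [sub_zero] using h.integrable_sq
  integral_sq_le := by simpa only [sub_zero] using h.integral_sq_le

variable {φ : E → ℝ} {W : AddSubgroup E} {L : ℝ}

theorem UnbiasedEstimate.lintegral_add_le (h : UnbiasedEstimate P Y 0 v) (hYW : ∀ ξ, Y ξ ∈ W)
    (hφ₀ : ∀ A ∈ W, 0 ≤ φ A) (hL : 0 ≤ L) (hφ : HasQuadraticMajorantOn φ W L) {A : E}
    (hA : A ∈ W) :
    ∫⁻ ξ, ENNReal.ofReal (φ (A + Y ξ)) ∂P ≤ ENNReal.ofReal (φ A + L * v) := by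
  obtain ⟨ℓ, hℓ⟩ := hφ A hA
  have hsq : Integrable (fun ξ => L * ‖Y ξ‖ ^ 2) P := by
    simpa only [sub_zero] using h.integrable_sq.const_mul L
  have hlin : Integrable (fun ξ => φ A + ℓ (Y ξ)) P :=
    (integrable_const _).add (ℓ.integrable_comp h.integrable)
  calc ∫⁻ ξ, ENNReal.ofReal (φ (A + Y ξ)) ∂P
      ≤ ∫⁻ ξ, ENNReal.ofReal (φ A + ℓ (Y ξ) + L * ‖Y ξ‖ ^ 2) ∂P :=
        lintegral_mono fun ξ => ENNReal.ofReal_le_ofReal (hℓ _ (hYW ξ))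
    _ = ENNReal.ofReal (∫ ξ, (φ A + ℓ (Y ξ) + L * ‖Y ξ‖ ^ 2) ∂P) :=
        (ofReal_integral_eq_lintegral_ofReal (hlin.add hsq) (.of_forall fun ξ =>
          (hφ₀ _ (W.add_mem hA (hYW ξ))).trans (hℓ _ (hYW ξ)))).symm
    _ ≤ ENNReal.ofReal (φ A + L * v) := by
        refine ENNReal.ofReal_le_ofReal ?_
        have hv : ∫ ξ, ‖Y ξ‖ ^ 2 ∂P ≤ v := by simpa only [sub_zero] using h.integral_sq_le
        rw [integral_add hlin hsq,
          integral_add (integrable_const _) (ℓ.integrable_comp h.integrable),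
          ℓ.integral_comp_comm h.integrable, h.integral_eq, integral_const_mul]
        simp only [integral_const, map_zero, probReal_univ, one_smul, add_zero]
        gcongr

variable [BorelSpace E] [SecondCountableTopology E]

theorem UnbiasedEstimate.lintegral_sum_le (h : UnbiasedEstimate P Y 0 v) (hYW : ∀ ξ, Y ξ ∈ W)
    (hφc : Continuous φ) (hφ₀ : ∀ A ∈ W, 0 ≤ φ A) (hL : 0 ≤ L)
    (hφ : HasQuadraticMajorantOn φ W L) (m : ℕ) :
    ∫⁻ s : Fin m → Ξ, ENNReal.ofReal (φ (∑ i, Y (s i))) ∂(Measure.pi fun _ => P)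
      ≤ ENNReal.ofReal (φ 0 + m * (L * v)) := by
  have hLv : 0 ≤ L * v := mul_nonneg hL h.variance_nonneg
  have hW : ∀ m (s : Fin m → Ξ), ∑ i, Y (s i) ∈ W := fun m s => W.sum_mem fun i _ => hYW _
  induction m with
  | zero => simp
  | succ m ih =>
    rw [lintegral_pi_succ_sum h.measurable hφc.measurable.ennreal_ofReal]
    calc ∫⁻ s, ∫⁻ ξ, ENNReal.ofReal (φ (∑ i, Y (s i) + Y ξ)) ∂P ∂(Measure.pi fun _ => P)
        ≤ ∫⁻ s, (ENNReal.ofReal (φ (∑ i, Y (s i))) + ENNReal.ofReal (L * v))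
            ∂(Measure.pi fun _ => P) := by
          refine lintegral_mono fun s => ?_
          rw [← ENNReal.ofReal_add (hφ₀ _ (hW m s)) hLv]
          exact h.lintegral_add_le hYW hφ₀ hL hφ (hW m s)
      _ = ∫⁻ s, ENNReal.ofReal (φ (∑ i, Y (s i))) ∂(Measure.pi fun _ => P)
            + ENNReal.ofReal (L * v) := by
          rw [lintegral_add_right _ measurable_const, lintegral_const, measure_univ, mul_one]
      _ ≤ ENNReal.ofReal (φ 0 + m * (L * v)) + ENNReal.ofReal (L * v) := by gcongr
      _ = ENNReal.ofReal (φ 0 + (m + 1 : ℕ) * (L * v)) := by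
          have hφ0 := hφ₀ 0 W.zero_mem
          rw [← ENNReal.ofReal_add (by positivity) hLv]
          push_cast
          congr 1
          ring

theorem UnbiasedEstimate.lintegral_sampleMean_sub_sq_le (h : UnbiasedEstimate P Z z v)
    (hZW : ∀ ξ, Z ξ ∈ W) (hzW : z ∈ W) (hφc : Continuous φ) (hφ_sq : ∀ A ∈ W, ‖A‖ ^ 2 ≤ φ A)
    (hL : 0 ≤ L) (hφ : HasQuadraticMajorantOn φ W L) {m : ℕ} (hm : 0 < m) :
    ∫⁻ s : Fin m → Ξ, ‖sampleMean Z s - z‖ₑ ^ 2 ∂(Measure.pi fun _ => P)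
      ≤ ENNReal.ofReal ((φ 0 + m * (L * v)) / m ^ 2) := by
  have hW : ∀ ξ, Z ξ - z ∈ W := fun ξ => W.sub_mem (hZW ξ) hzW
  have hpt : ∀ s : Fin m → Ξ, ‖sampleMean Z s - z‖ₑ ^ 2
      ≤ ENNReal.ofReal ((m : ℝ) ^ 2)⁻¹ * ENNReal.ofReal (φ (∑ i, (Z (s i) - z))) := fun s => by
    rw [← ofReal_norm, ← ENNReal.ofReal_pow (norm_nonneg _), ← ENNReal.ofReal_mul (by positivity),
      sampleMean_sub hm, norm_smul, mul_pow, norm_inv, Real.norm_natCast, inv_pow]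
    gcongr
    exact hφ_sq _ (W.sum_mem fun i _ => hW _)
  calc ∫⁻ s : Fin m → Ξ, ‖sampleMean Z s - z‖ₑ ^ 2 ∂(Measure.pi fun _ => P)
      ≤ ENNReal.ofReal ((m : ℝ) ^ 2)⁻¹ * ENNReal.ofReal (φ 0 + m * (L * v)) := by
        refine (lintegral_mono hpt).trans ?_
        rw [lintegral_const_mul' _ _ ENNReal.ofReal_ne_top]
        gcongr
        exact h.sub_const.lintegral_sum_le hW hφc (fun A hA => (sq_nonneg _).trans (hφ_sq A hA))
          hL hφ m
    _ = ENNReal.ofReal ((φ 0 + m * (L * v)) / m ^ 2) := by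
        rw [← ENNReal.ofReal_mul (by positivity), div_eq_inv_mul]

theorem UnbiasedEstimate.lintegral_sampleMean_sub_le (h : UnbiasedEstimate P Z z v)
    (hZW : ∀ ξ, Z ξ ∈ W) (hzW : z ∈ W) (hφc : Continuous φ) (hφ_sq : ∀ A ∈ W, ‖A‖ ^ 2 ≤ φ A)
    (hL : 0 ≤ L) (hφ : HasQuadraticMajorantOn φ W L) {m : ℕ} (hm : 0 < m) :
    ∫⁻ s : Fin m → Ξ, ‖sampleMean Z s - z‖ₑ ∂(Measure.pi fun _ => P)
      ≤ ENNReal.ofReal (Real.sqrt ((φ 0 + m * (L * v)) / m ^ 2)) :=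
  lintegral_enorm_le_ofReal_sqrt
    (((Finset.measurable_sum _ fun i _ =>
      h.measurable.comp (measurable_pi_apply i)).const_smul _).sub_const z)
    (h.lintegral_sampleMean_sub_sq_le hZW hzW hφc hφ_sq hL hφ hm)

end Sampling

section SamplingHilbert

variable {E Ξ : Type*} [NormedAddCommGroup E] [InnerProductSpace ℝ E] [MeasurableSpace Ξ]
  {P : Measure Ξ} [IsProbabilityMeasure P] {v : ℝ}

theorem UnbiasedEstimate.lintegral_sampleMean_sub_le_sqrt_div [CompleteSpace E] [MeasurableSpace E]
    [BorelSpace E] [SecondCountableTopology E] {Z : Ξ → E} {z : E}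
    (h : UnbiasedEstimate P Z z v) {m : ℕ} (hm : 0 < m) :
    ∫⁻ s : Fin m → Ξ, ‖sampleMean Z s - z‖ₑ ∂(Measure.pi fun _ => P)
      ≤ ENNReal.ofReal (Real.sqrt (v / m)) := by
  have hm₀ : (m : ℝ) ≠ 0 := by exact_mod_cast hm.ne'
  have hbound := h.lintegral_sampleMean_sub_le (W := ⊤) (fun _ => trivial) trivial (by fun_prop)
    (fun _ _ => le_rfl) zero_le_one hasQuadraticMajorantOn_norm_sq hm
  have hval : (‖(0 : E)‖ ^ 2 + m * (1 * v)) / (m : ℝ) ^ 2 = v / m := by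
    rw [norm_zero]
    field_simp
    ring
  rwa [hval] at hbound

theorem mul_rpow_one_div_le_mul_log {n : ℕ} (hn : 2 ≤ n) {p : ℕ} (hp : p = ⌈Real.log n⌉₊) :
    (2 * p + 1) * (n : ℝ) ^ (1 / ((p : ℝ) + 1)) ≤ 22 * Real.log n := by
  have hn₂ : (2 : ℝ) ≤ n := by exact_mod_cast hn
  have hlog : 0.69 ≤ Real.log n :=
    (by linarith [Real.log_two_gt_d9] : (0.69 : ℝ) ≤ Real.log 2).trans
      (Real.log_le_log (by norm_num) hn₂)
  have hp_le : (p : ℝ) ≤ Real.log n + 1 := hp ▸ (Nat.ceil_lt_add_one (by linarith)).le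
  have hp_ge : Real.log n ≤ p := hp ▸ Nat.le_ceil _
  -- The order `p` is chosen so that this root is at most `n ^ (1 / log n) = e`.
  have hroot : (n : ℝ) ^ (1 / ((p : ℝ) + 1)) ≤ 2.7182818286 := by
    rw [Real.rpow_def_of_pos (by linarith)]
    refine le_trans ?_ Real.exp_one_lt_d9.le
    rw [Real.exp_le_exp, mul_one_div, div_le_one (by positivity)]
    linarith
  calc (2 * p + 1) * (n : ℝ) ^ (1 / ((p : ℝ) + 1))
      ≤ (2 * (Real.log n + 1) + 1) * 2.7182818286 := by gcongr
    _ ≤ 22 * Real.log n := by linarith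

theorem UnbiasedEstimate.lintegral_opNorm_sampleMean_sub_le [FiniteDimensional ℝ E]
    (hn : 2 ≤ Module.finrank ℝ E) {Z : Ξ → E →L[ℝ] E} {z : E →L[ℝ] E}
    (h : UnbiasedEstimate P Z z v) (hZsa : ∀ ξ, IsSelfAdjoint (Z ξ)) (hzsa : IsSelfAdjoint z)
    {m : ℕ} {ε : ℝ} (hε : 0 < ε) (hm : 22 * Real.log (Module.finrank ℝ E) * ε⁻¹ ≤ m) :
    ∫⁻ s : Fin m → Ξ, ‖sampleMean Z s - z‖ₑ ∂(Measure.pi fun _ => P)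
      ≤ ENNReal.ofReal (Real.sqrt (ε * (1 + v))) := by
  have hlog : 0 < Real.log (Module.finrank ℝ E) := Real.log_pos (by exact_mod_cast hn)
  have hm₀ : (0 : ℝ) < m := lt_of_lt_of_le (by positivity) hm
  have hmε : 22 * Real.log (Module.finrank ℝ E) ≤ m * ε := by
    rwa [← div_eq_mul_inv, div_le_iff₀ hε] at hm
  obtain ⟨p, hp⟩ : ∃ p : ℕ, p = ⌈Real.log (Module.finrank ℝ E)⌉₊ := ⟨_, rfl⟩
  have hp₁ : 1 ≤ p := hp ▸ Nat.one_le_ceil_iff.2 hlog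
  have hτ : 0 < (m : ℝ) ^ 2 * ε := by positivity
  refine (h.lintegral_sampleMean_sub_le (W := selfAdjoint (E →L[ℝ] E)) hZsa hzsa
    (continuous_tracePotential p ((m : ℝ) ^ 2 * ε))
    (fun A hA => opNorm_sq_le_tracePotential p hτ.le hA) (by positivity)
    (hasQuadraticMajorantOn_tracePotential hp₁ hτ) (by exact_mod_cast hm₀)).trans
    (ENNReal.ofReal_le_ofReal (Real.sqrt_le_sqrt ?_))
  rw [tracePotential_zero p hτ.le, div_le_iff₀ (by positivity)]
  have hL := mul_le_mul_of_nonneg_right ((mul_rpow_one_div_le_mul_log hn hp).trans hmε)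
    h.variance_nonneg
  calc (m : ℝ) ^ 2 * ε + m * ((2 * p + 1) *
          (Module.finrank ℝ E : ℝ) ^ (1 / ((p : ℝ) + 1)) * v)
      ≤ m ^ 2 * ε + m * (m * ε * v) := by gcongr
    _ = ε * (1 + v) * m ^ 2 := by ring

end SamplingHilbert

section Smoothness

theorem hasDerivAt_apply_add_smul {E : Type*} [NormedAddCommGroup E] [InnerProductSpace ℝ E]
    [CompleteSpace E] {F : E → ℝ} (hF : Differentiable ℝ F) (x d : E) (s : ℝ) :
    HasDerivAt (fun s : ℝ => F (x + s • d)) (inner ℝ (gradient F (x + s • d)) d) s := by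
  rw [inner_gradient_left]
  exact (hF _).hasFDerivAt.comp_hasDerivAt s (hasDerivAt_add_smul x d s)

variable {n : ℕ} {F : Vec n → ℝ} {x d : Vec n} {L₀ L₁ : ℝ}

theorem isSelfAdjoint_hess (hF : TwiceDifferentiable F) (x : Vec n) : IsSelfAdjoint (hess F x) := by
  rw [ContinuousLinearMap.isSelfAdjoint_iff_isSymmetric]
  have hasFDerivAt_fderiv : HasFDerivAt (fderiv ℝ F)
      ((InnerProductSpace.toDual ℝ (Vec n)).toContinuousLinearEquiv.toContinuousLinearMap ∘L
        hess F x) x := by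
    refine ((ContinuousLinearMap.hasFDerivAt _).comp x
      (hF.2 x).hasFDerivAt).congr_of_eventuallyEq (Filter.Eventually.of_forall fun y => ?_)
    exact (toDual_gradient (𝕜 := ℝ) (f := F) (x := y)).symm
  intro v w
  rw [ContinuousLinearMap.coe_coe, real_inner_comm (hess F x w)]
  exact second_derivative_symmetric (fun y => (hF.1 y).hasFDerivAt) hasFDerivAt_fderiv v w

theorem SecondOrderSmooth.continuous_hess {δ M₀ M₁ : ℝ} (hδ : 0 < δ)
    (hF : SecondOrderSmooth F δ M₀ M₁) : Continuous (hess F) := by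
  refine continuous_iff_continuousAt.2 fun x => tendsto_iff_norm_sub_tendsto_zero.2 ?_
  have hlim : Filter.Tendsto (fun y => (M₀ + M₁ * ‖gradient F x‖) * ‖x - y‖) (nhds x) (nhds 0) := by
    have : Continuous fun y => (M₀ + M₁ * ‖gradient F x‖) * ‖x - y‖ := by fun_prop
    simpa using this.tendsto x
  refine squeeze_zero' (Filter.Eventually.of_forall fun _ => norm_nonneg _) ?_ hlim
  filter_upwards [Metric.ball_mem_nhds x hδ] with y hy
  rw [norm_sub_rev]
  exact hF.2 x y (by rw [← dist_eq_norm, dist_comm]; exact (Metric.mem_ball.1 hy).le)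

theorem GeneralizedSmooth.norm_hess_le (hL₀ : 0 ≤ L₀) (hL₁ : 0 ≤ L₁)
    (hF : GeneralizedSmooth F L₀ L₁) (hF₂ : TwiceDifferentiable F) (x : Vec n) :
    ‖hess F x‖ ≤ L₀ + L₁ * ‖gradient F x‖ := by
  refine (hF₂.2 x).hasFDerivAt.le_of_lip' (by positivity) ?_
  have near : ∀ᶠ y in nhds x, L₁ * ‖x - y‖ < 1 := by
    have : Continuous fun y => L₁ * ‖x - y‖ := by fun_prop
    exact this.continuousAt.eventually_lt continuousAt_const (by simp)
  filter_upwards [near] with y hy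
  rw [norm_sub_rev, norm_sub_rev y]
  exact hF.2 x y hy.le

theorem GeneralizedSmooth.norm_gradient_sub_le (hF : GeneralizedSmooth F L₀ L₁)
    (hd : L₁ * ‖d‖ ≤ 1) :
    ‖gradient F (x + d) - gradient F x‖ ≤ (L₀ + L₁ * ‖gradient F x‖) * ‖d‖ := by
  simpa [norm_sub_rev] using hF.2 x (x + d) (by simpa using hd)

theorem GeneralizedSmooth.norm_gradient_add_le {Δ : ℝ} (hL₀ : 0 ≤ L₀) (hL₁ : 0 ≤ L₁)
    (hΔ : L₁ * Δ ≤ 1) (hF : GeneralizedSmooth F L₀ L₁) (hd : ‖d‖ ≤ Δ) :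
    ‖gradient F (x + d)‖ ≤ 2 * ‖gradient F x‖ + L₀ * Δ := by
  have hd₁ : L₁ * ‖d‖ ≤ 1 := (mul_le_mul_of_nonneg_left hd hL₁).trans hΔ
  calc ‖gradient F (x + d)‖
      ≤ ‖gradient F x‖ + ‖gradient F (x + d) - gradient F x‖ := norm_le_insert' _ _
    _ ≤ ‖gradient F x‖ + (L₀ + L₁ * ‖gradient F x‖) * ‖d‖ := by
      gcongr
      exact hF.norm_gradient_sub_le hd₁
    _ = ‖gradient F x‖ + L₀ * ‖d‖ + L₁ * ‖d‖ * ‖gradient F x‖ := by ring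
    _ ≤ ‖gradient F x‖ + L₀ * Δ + 1 * ‖gradient F x‖ := by gcongr
    _ = 2 * ‖gradient F x‖ + L₀ * Δ := by ring

theorem GeneralizedSmooth.apply_add_le (hL₁ : 0 ≤ L₁) (hF : GeneralizedSmooth F L₀ L₁)
    (hd : L₁ * ‖d‖ ≤ 1) :
    F (x + d) ≤ F x + inner ℝ (gradient F x) d
      + (L₀ + L₁ * ‖gradient F x‖) / 2 * ‖d‖ ^ 2 := by
  set L := L₀ + L₁ * ‖gradient F x‖
  have hquad : ∀ s, HasDerivAt
      (fun s : ℝ => F x + s * inner ℝ (gradient F x) d + s ^ 2 * (L / 2 * ‖d‖ ^ 2))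
      (inner ℝ (gradient F x) d + L * s * ‖d‖ ^ 2) s := fun s =>
    ((((hasDerivAt_id s).mul_const _).const_add (F x)).add
      ((hasDerivAt_pow 2 s).mul_const _)).congr_deriv (by simp; ring)
  have := le_of_hasDerivAt_le (hasDerivAt_apply_add_smul hF.1 x d) hquad (by simp) zero_le_one
    fun s hs => ?_
  · simpa using this
  have hsd : ‖s • d‖ = s * ‖d‖ := by rw [norm_smul, Real.norm_of_nonneg hs.1]
  have hsd₁ : L₁ * ‖s • d‖ ≤ 1 :=
    (mul_le_mul_of_nonneg_left
      (hsd.trans_le (mul_le_of_le_one_left (norm_nonneg d) hs.2.le)) hL₁).trans hd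
  calc inner ℝ (gradient F (x + s • d)) d
      = inner ℝ (gradient F x) d + inner ℝ (gradient F (x + s • d) - gradient F x) d := by
        rw [inner_sub_left]; ring
    _ ≤ inner ℝ (gradient F x) d + L * ‖s • d‖ * ‖d‖ := by
        gcongr
        exact (real_inner_le_norm _ _).trans
          (mul_le_mul_of_nonneg_right (hF.norm_gradient_sub_le hsd₁) (norm_nonneg d))
    _ = inner ℝ (gradient F x) d + L * s * ‖d‖ ^ 2 := by rw [hsd]; ring

theorem GeneralizedSmooth.norm_gradient_sq_le {D : ℝ} (hL₀ : 0 < L₀) (hL₁ : 0 ≤ L₁)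
    (hF : GeneralizedSmooth F L₀ L₁) (hD : ∀ y, F x - F y ≤ D) :
    ‖gradient F x‖ ^ 2 ≤ 2 * D * (L₀ + L₁ * ‖gradient F x‖) := by
  set L := L₀ + L₁ * ‖gradient F x‖ with hL
  have hL_pos : 0 < L := by positivity
  have hnorm : ‖-(L⁻¹ • gradient F x)‖ = L⁻¹ * ‖gradient F x‖ := by
    rw [norm_neg, norm_smul, Real.norm_of_nonneg (by positivity)]
  have hstep : L₁ * ‖-(L⁻¹ • gradient F x)‖ ≤ 1 := by
    rw [hnorm, mul_left_comm, inv_mul_le_iff₀ hL_pos, mul_one, hL]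
    exact le_add_of_nonneg_left hL₀.le
  have hdecrease := hF.apply_add_le (x := x) hL₁ hstep
  rw [hnorm, inner_neg_right, inner_smul_right, real_inner_self_eq_norm_sq, ← hL] at hdecrease
  have hquad : L / 2 * (L⁻¹ * ‖gradient F x‖) ^ 2 = L⁻¹ * ‖gradient F x‖ ^ 2 / 2 := by
    field_simp
  rw [mul_comm, ← inv_mul_le_iff₀ hL_pos]
  linarith [hD (x + -(L⁻¹ • gradient F x))]

theorem GeneralizedSmooth.norm_gradient_le {D : ℝ} (hL₀ : 0 < L₀) (hL₁ : 0 ≤ L₁)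
    (hF : GeneralizedSmooth F L₀ L₁) (hD : ∀ y, F x - F y ≤ D) :
    ‖gradient F x‖ ≤ 2 * D * (L₀ + L₁) + 1 := by
  have hD₀ : 0 ≤ D := by simpa using hD x
  rcases le_total ‖gradient F x‖ 1 with hle | hge
  · have : 0 ≤ 2 * D * (L₀ + L₁) := by positivity
    linarith
  · have hmul : ‖gradient F x‖ * ‖gradient F x‖ ≤ 2 * D * (L₀ + L₁) * ‖gradient F x‖ :=
      calc ‖gradient F x‖ * ‖gradient F x‖ ≤ 2 * D * (L₀ + L₁ * ‖gradient F x‖) := by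
            simpa [sq] using hF.norm_gradient_sq_le hL₀ hL₁ hD
        _ ≤ 2 * D * (L₀ * ‖gradient F x‖ + L₁ * ‖gradient F x‖) := by
            gcongr
            exact le_mul_of_one_le_right hL₀.le hge
        _ = 2 * D * (L₀ + L₁) * ‖gradient F x‖ := by ring
    linarith [le_of_mul_le_mul_right hmul (by linarith)]

variable {M : ℝ}

theorem norm_gradient_add_sub_sub_hess_le (hF : Differentiable ℝ (gradient F))
    (h : ∀ y, ‖x - y‖ ≤ ‖d‖ → ‖hess F x - hess F y‖ ≤ M * ‖x - y‖) :
    ‖gradient F (x + d) - gradient F x - hess F x d‖ ≤ M / 2 * ‖d‖ ^ 2 := by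
  have hderiv : ∀ s : ℝ, HasDerivAt
      (fun s : ℝ => gradient F (x + s • d) - gradient F x - s • hess F x d)
      ((hess F (x + s • d) - hess F x) d) s := fun s =>
    ((((hF _).hasFDerivAt.comp_hasDerivAt s (hasDerivAt_add_smul x d s)).sub_const _).sub
      ((hasDerivAt_id s).smul_const (hess F x d))).congr_deriv (by simp [hess])
  have hquad : ∀ s, HasDerivAt (fun s : ℝ => s ^ 2 * (M / 2 * ‖d‖ ^ 2)) (M * s * ‖d‖ ^ 2) s :=
    fun s => ((hasDerivAt_pow 2 s).mul_const _).congr_deriv (by simp; ring)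
  have := image_norm_le_of_norm_deriv_right_le_deriv_boundary
    (fun s _ => (hderiv s).continuousAt.continuousWithinAt)
    (fun s _ => (hderiv s).hasDerivWithinAt) (by simp) hquad (fun s hs => ?_)
    (Set.right_mem_Icc.2 zero_le_one)
  · simpa using this
  have hsd : ‖s • d‖ = s * ‖d‖ := by rw [norm_smul, Real.norm_of_nonneg hs.1]
  have hlip : ‖hess F (x + s • d) - hess F x‖ ≤ M * ‖s • d‖ := by
    simpa [norm_sub_rev] using h (x + s • d)
      (by simpa [hsd] using mul_le_of_le_one_left (norm_nonneg d) hs.2.le)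
  calc ‖(hess F (x + s • d) - hess F x) d‖ ≤ M * ‖s • d‖ * ‖d‖ :=
        (ContinuousLinearMap.le_opNorm _ _).trans (by gcongr)
    _ = M * s * ‖d‖ ^ 2 := by rw [hsd]; ring

theorem apply_add_le_of_norm_hess_sub_le (hF : TwiceDifferentiable F)
    (h : ∀ y, ‖x - y‖ ≤ ‖d‖ → ‖hess F x - hess F y‖ ≤ M * ‖x - y‖) :
    F (x + d) ≤ F x + inner ℝ (gradient F x) d + 1 / 2 * inner ℝ d (hess F x d)
      + M / 6 * ‖d‖ ^ 3 := by
  have hcubic : ∀ s, HasDerivAt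
      (fun s : ℝ => F x + s * inner ℝ (gradient F x) d + s ^ 2 * (1 / 2 * inner ℝ d (hess F x d))
        + s ^ 3 * (M / 6 * ‖d‖ ^ 3))
      (inner ℝ (gradient F x) d + s * inner ℝ d (hess F x d) + M / 2 * s ^ 2 * ‖d‖ ^ 3) s :=
    fun s => (((((hasDerivAt_id s).mul_const _).const_add (F x)).add
      ((hasDerivAt_pow 2 s).mul_const _)).add
        ((hasDerivAt_pow 3 s).mul_const _)).congr_deriv (by simp; ring)
  have := le_of_hasDerivAt_le (hasDerivAt_apply_add_smul hF.1 x d) hcubic (by simp) zero_le_one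
    fun s hs => ?_
  · simpa using this
  have hsd : ‖s • d‖ = s * ‖d‖ := by rw [norm_smul, Real.norm_of_nonneg hs.1]
  have hgrad : ‖gradient F (x + s • d) - gradient F x - hess F x (s • d)‖
      ≤ M / 2 * ‖s • d‖ ^ 2 :=
    norm_gradient_add_sub_sub_hess_le hF.2 fun y hy =>
      h y (hy.trans (hsd.trans_le (mul_le_of_le_one_left (norm_nonneg d) hs.2.le)))
  calc inner ℝ (gradient F (x + s • d)) d
      = inner ℝ (gradient F x) d + s * inner ℝ d (hess F x d)
        + inner ℝ (gradient F (x + s • d) - gradient F x - hess F x (s • d)) d := by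
        rw [inner_sub_left, inner_sub_left, map_smul, real_inner_smul_left,
          real_inner_comm d (hess F x d)]
        ring
    _ ≤ inner ℝ (gradient F x) d + s * inner ℝ d (hess F x d) + M / 2 * ‖s • d‖ ^ 2 * ‖d‖ := by
        gcongr
        exact (real_inner_le_norm _ _).trans (by gcongr)
    _ = inner ℝ (gradient F x) d + s * inner ℝ d (hess F x d) + M / 2 * s ^ 2 * ‖d‖ ^ 3 := by
        rw [hsd]; ring

end Smoothness

section Multiplier

section Ball

variable {E : Type*} [NormedAddCommGroup E] [InnerProductSpace ℝ E] {w d v : E} {Δ : ℝ}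

theorem exists_eq_neg_smul_of_inner_sub_nonneg (hΔ : 0 < Δ) (hd : ‖d‖ ≤ Δ)
    (h : ∀ e, ‖e‖ ≤ Δ → 0 ≤ inner ℝ w (e - d)) :
    ∃ lam : ℝ, 0 ≤ lam ∧ w = -(lam • d) ∧ lam * ‖d‖ = lam * Δ := by
  rcases eq_or_ne w 0 with rfl | hw
  · exact ⟨0, le_rfl, by simp, by simp⟩
  have hw₀ : 0 < ‖w‖ := norm_pos_iff.2 hw
  have hinner : inner ℝ w d ≤ -(‖w‖ * Δ) := by
    have := h (-((Δ / ‖w‖) • w)) (by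
      rw [norm_neg, norm_smul, Real.norm_of_nonneg (by positivity), div_mul_cancel₀ _ hw₀.ne'])
    rw [inner_sub_right, inner_neg_right, real_inner_smul_right, real_inner_self_eq_norm_sq] at this
    linarith [show Δ / ‖w‖ * ‖w‖ ^ 2 = ‖w‖ * Δ by field_simp]
  have hlam : ‖w‖ / Δ * Δ = ‖w‖ := div_mul_cancel₀ _ hΔ.ne'
  have hw_eq : w = -((‖w‖ / Δ) • d) := by
    refine eq_neg_of_add_eq_zero_left (norm_eq_zero.1 (pow_eq_zero_iff two_ne_zero |>.1
      (le_antisymm ?_ (sq_nonneg _))))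
    have hnorm : (‖w‖ / Δ * ‖d‖) ^ 2 ≤ ‖w‖ ^ 2 := by
      gcongr
      exact (mul_le_mul_of_nonneg_left hd (by positivity)).trans_eq hlam
    have hcross : ‖w‖ / Δ * inner ℝ w d ≤ -‖w‖ ^ 2 :=
      (mul_le_mul_of_nonneg_left hinner (by positivity)).trans_eq
        (by linear_combination -‖w‖ * hlam)
    rw [norm_add_sq_real, real_inner_smul_right, norm_smul, Real.norm_of_nonneg (by positivity)]
    linarith
  refine ⟨‖w‖ / Δ, by positivity, hw_eq, ?_⟩
  calc ‖w‖ / Δ * ‖d‖ = ‖-((‖w‖ / Δ) • d)‖ := by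
        rw [norm_neg, norm_smul, Real.norm_of_nonneg (by positivity)]
    _ = ‖w‖ / Δ * Δ := by rw [← hw_eq, hlam]

theorem exists_ne_zero_norm_add_smul_le (hd : ‖d‖ < Δ) (v : E) :
    ∃ τ : ℝ, τ ≠ 0 ∧ ‖d + τ • v‖ ≤ Δ := by
  have near : ∀ᶠ τ : ℝ in nhdsWithin 0 {0}ᶜ, ‖d + τ • v‖ < Δ := by
    have : Continuous fun τ : ℝ => ‖d + τ • v‖ := by fun_prop
    exact nhdsWithin_le_nhds (this.continuousAt.eventually_lt continuousAt_const (by simpa))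
  obtain ⟨τ, hτ, hτ₀⟩ := (near.and self_mem_nhdsWithin).exists
  exact ⟨τ, hτ₀, hτ.le⟩

theorem exists_ne_zero_norm_add_smul_eq (hv : inner ℝ v d ≠ 0) :
    ∃ τ : ℝ, τ ≠ 0 ∧ ‖d + τ • v‖ = ‖d‖ := by
  have hv₀ : v ≠ 0 := by rintro rfl; simp at hv
  have hτ : -2 * inner ℝ v d / ‖v‖ ^ 2 * ‖v‖ ^ 2 = -2 * inner ℝ v d :=
    div_mul_cancel₀ _ (by positivity)
  refine ⟨-2 * inner ℝ v d / ‖v‖ ^ 2, by positivity, ?_⟩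
  rw [← sq_eq_sq₀ (norm_nonneg _) (norm_nonneg _), norm_add_sq_real, real_inner_smul_right,
    norm_smul, mul_pow, Real.norm_eq_abs, sq_abs, real_inner_comm v d]
  linear_combination -2 * inner ℝ v d / ‖v‖ ^ 2 * hτ

end Ball

variable {n : ℕ} {c Δ lam : ℝ} {g d v : Vec n} {B : Vec n →L[ℝ] Vec n}

theorem model_sub_model (hB : IsSelfAdjoint B) (d e : Vec n) :
    model c g B e - model c g B d
      = inner ℝ (g + B d) (e - d) + 1 / 2 * inner ℝ (e - d) (B (e - d)) := by
  have hsymm : inner ℝ (B d) e = inner ℝ d (B e) :=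
    (ContinuousLinearMap.isSelfAdjoint_iff_isSymmetric.1 hB) d e
  simp only [model, map_sub, inner_sub_right, inner_sub_left, inner_add_left]
  linarith [real_inner_comm e (B d), real_inner_comm d (B d)]

theorem SolvesSubproblem.inner_sub_nonneg (hB : IsSelfAdjoint B)
    (h : SolvesSubproblem c g B Δ d) {e : Vec n} (he : ‖e‖ ≤ Δ) :
    0 ≤ inner ℝ (g + B d) (e - d) := by
  set a := inner ℝ (g + B d) (e - d)
  set q := inner ℝ (e - d) (B (e - d)) with hq
  have hlim : Filter.Tendsto (fun s : ℝ => a + 1 / 2 * (s * q)) (nhdsWithin 0 (Set.Ioi 0))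
      (nhds a) := by
    have : Continuous fun s : ℝ => a + 1 / 2 * (s * q) := by fun_prop
    simpa using (this.tendsto 0).mono_left nhdsWithin_le_nhds
  refine ge_of_tendsto hlim ?_
  filter_upwards [Ioc_mem_nhdsGT zero_lt_one] with s hs
  have hball : ‖d + s • (e - d)‖ ≤ Δ := by
    simpa using (convex_closedBall (0 : Vec n) Δ).add_smul_sub_mem (by simpa using h.1)
      (by simpa using he) (Set.Ioc_subset_Icc_self hs)
  have hmodel := model_sub_model (c := c) (g := g) hB d (d + s • (e - d))
  rw [add_sub_cancel_left, map_smul, real_inner_smul_right, real_inner_smul_left,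
    real_inner_smul_right, ← hq] at hmodel
  refine nonneg_of_mul_nonneg_right (a := s) ?_ hs.1
  linarith [h.2 _ hball]

theorem SolvesSubproblem.curvature_nonneg_of_norm_eq (hB : IsSelfAdjoint B)
    (h : SolvesSubproblem c g B Δ d) (hlam : g + B d = -(lam • d)) {τ : ℝ} (hτ₀ : τ ≠ 0)
    (hτ : ‖d + τ • v‖ ≤ Δ) (hnorm : lam * ‖d + τ • v‖ ^ 2 = lam * ‖d‖ ^ 2) :
    0 ≤ inner ℝ v (B v) + lam * ‖v‖ ^ 2 := by
  have hmodel := model_sub_model (c := c) (g := g) hB d (d + τ • v)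
  rw [add_sub_cancel_left, hlam, map_smul, real_inner_smul_right, real_inner_smul_left,
    real_inner_smul_right, inner_neg_left, real_inner_smul_left] at hmodel
  rw [norm_add_sq_real, real_inner_smul_right, norm_smul, mul_pow, Real.norm_eq_abs,
    sq_abs] at hnorm
  refine nonneg_of_mul_nonneg_right (a := τ ^ 2) ?_ (by positivity)
  linear_combination 2 * h.2 _ hτ + 2 * hmodel - hnorm

theorem SolvesSubproblem.curvature_nonneg (hB : IsSelfAdjoint B) (hΔ : 0 < Δ)
    (h : SolvesSubproblem c g B Δ d) (hlam : g + B d = -(lam • d))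
    (hcompl : lam * ‖d‖ = lam * Δ) (v : Vec n) : 0 ≤ inner ℝ v (B v) + lam * ‖v‖ ^ 2 := by
  rcases h.1.lt_or_eq with hlt | hd
  · obtain ⟨τ, hτ₀, hτ⟩ := exists_ne_zero_norm_add_smul_le hlt v
    have hlam₀ : lam = 0 := by_contra fun hne => hlt.ne (mul_left_cancel₀ hne hcompl)
    exact h.curvature_nonneg_of_norm_eq hB hlam hτ₀ hτ (by simp [hlam₀])
  have of_inner_ne_zero : ∀ v : Vec n, inner ℝ v d ≠ 0 →
      0 ≤ inner ℝ v (B v) + lam * ‖v‖ ^ 2 := fun v hv => by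
    obtain ⟨τ, hτ₀, hτ⟩ := exists_ne_zero_norm_add_smul_eq hv
    exact h.curvature_nonneg_of_norm_eq hB hlam hτ₀ (hτ.trans_le h.1) (by rw [hτ])
  by_cases hv : inner ℝ v d = 0
  · have hlim : Filter.Tendsto
        (fun s : ℝ => inner ℝ (v + s • d) (B (v + s • d)) + lam * ‖v + s • d‖ ^ 2)
        (nhdsWithin 0 (Set.Ioi 0)) (nhds (inner ℝ v (B v) + lam * ‖v‖ ^ 2)) := by
      have : Continuous fun s : ℝ =>
          inner ℝ (v + s • d) (B (v + s • d)) + lam * ‖v + s • d‖ ^ 2 := by fun_prop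
      simpa using (this.tendsto 0).mono_left nhdsWithin_le_nhds
    refine ge_of_tendsto hlim ?_
    filter_upwards [self_mem_nhdsWithin] with s hs
    refine of_inner_ne_zero _ ?_
    rw [inner_add_left, hv, real_inner_smul_left, real_inner_self_eq_norm_sq, zero_add, hd]
    exact mul_ne_zero (ne_of_gt hs) (by positivity)
  · exact of_inner_ne_zero v hv

theorem SolvesSubproblem.exists_multiplier (hB : IsSelfAdjoint B) (hΔ : 0 < Δ)
    (h : SolvesSubproblem c g B Δ d) :
    ∃ lam : ℝ, 0 ≤ lam ∧ g + B d = -(lam • d) ∧ lam * ‖d‖ = lam * Δ ∧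
      ∀ v, 0 ≤ inner ℝ v (B v) + lam * ‖v‖ ^ 2 := by
  obtain ⟨lam, hlam₀, hlam, hcompl⟩ := exists_eq_neg_smul_of_inner_sub_nonneg hΔ h.1
    fun e he => h.inner_sub_nonneg hB he
  exact ⟨lam, hlam₀, hlam, hcompl, h.curvature_nonneg hB hΔ hlam hcompl⟩

end Multiplier

section Projection

variable {n k : ℕ} {V : Matrix (Fin n) (Fin k) ℝ} {A : Vec n →L[ℝ] Vec n}

theorem isSelfAdjoint_proj (V : Matrix (Fin n) (Fin k) ℝ) : IsSelfAdjoint (proj V) := by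
  have h : IsSelfAdjoint (V * V.transpose) := by
    simp [isSelfAdjoint_iff, Matrix.star_eq_conjTranspose,
      Matrix.conjTranspose_eq_transpose_of_trivial]
  exact h.map (Matrix.toEuclideanCLM (n := Fin n) (𝕜 := ℝ))

theorem isStarProjection_proj (hV : V.transpose * V = 1) : IsStarProjection (proj V) where
  isIdempotentElem := by
    rw [IsIdempotentElem, proj, ← map_mul, Matrix.mul_assoc, ← Matrix.mul_assoc V.transpose, hV,
      Matrix.one_mul]
  isSelfAdjoint := isSelfAdjoint_proj V

theorem projected_eq_mul (V : Matrix (Fin n) (Fin k) ℝ) (A : Vec n →L[ℝ] Vec n) :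
    projected V A = proj V * A * proj V :=
  rfl

theorem isSelfAdjoint_projected (V : Matrix (Fin n) (Fin k) ℝ) (hA : IsSelfAdjoint A) :
    IsSelfAdjoint (projected V A) := by
  rw [projected_eq_mul]
  exact hA.conjugate_self (isSelfAdjoint_proj V)

theorem projected_sub (V : Matrix (Fin n) (Fin k) ℝ) (A B : Vec n →L[ℝ] Vec n) :
    projected V (A - B) = projected V A - projected V B := by
  simp only [projected_eq_mul, mul_sub, sub_mul]

theorem norm_projected_le (hV : V.transpose * V = 1) (A : Vec n →L[ℝ] Vec n) :
    ‖projected V A‖ ≤ ‖A‖ := by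
  have hP : ‖proj V‖ ≤ 1 := (isStarProjection_proj hV).norm_le
  rw [projected_eq_mul]
  calc ‖proj V * A * proj V‖ ≤ ‖proj V‖ * ‖A‖ * ‖proj V‖ := norm_mul₃_le
    _ ≤ 1 * ‖A‖ * 1 := by gcongr
    _ = ‖A‖ := by ring

theorem norm_sub_projected_apply_le (hV : V.transpose * V = 1) (A H : Vec n →L[ℝ] Vec n)
    (d : Vec n) :
    ‖(A - projected V H) d‖ ≤ ‖(A - projected V A) d‖ + ‖H - A‖ * ‖d‖ :=
  calc ‖(A - projected V H) d‖
      = ‖(A - projected V A) d - projected V (H - A) d‖ := by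
        simp only [projected_sub, sub_apply]
        abel_nf
    _ ≤ ‖(A - projected V A) d‖ + ‖projected V (H - A) d‖ := norm_sub_le _ _
    _ ≤ ‖(A - projected V A) d‖ + ‖H - A‖ * ‖d‖ := by
        gcongr
        exact (ContinuousLinearMap.le_opNorm _ _).trans (by gcongr; exact norm_projected_le hV _)

end Projection

section LambdaMin

theorem abs_inner_apply_le {E : Type*} [NormedAddCommGroup E] [InnerProductSpace ℝ E]
    (A : E →L[ℝ] E) (v : E) : |inner ℝ v (A v)| ≤ ‖A‖ * ‖v‖ ^ 2 :=
  calc |inner ℝ v (A v)| ≤ ‖v‖ * ‖A v‖ := abs_real_inner_le_norm _ _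
    _ ≤ ‖v‖ * (‖A‖ * ‖v‖) := by gcongr; exact A.le_opNorm v
    _ = ‖A‖ * ‖v‖ ^ 2 := by ring

theorem mem_spectrum_iff_exists_eigenvector {E : Type*} [NormedAddCommGroup E] [NormedSpace ℝ E]
    [FiniteDimensional ℝ E] {A : E →L[ℝ] E} {r : ℝ} :
    r ∈ spectrum ℝ A ↔ ∃ v, v ≠ 0 ∧ A v = r • v := by
  rw [ContinuousLinearMap.spectrum_eq, ← Module.End.hasEigenvalue_iff_mem_spectrum]
  constructor
  · intro h
    obtain ⟨v, hv⟩ := h.exists_hasEigenvector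
    exact ⟨v, hv.2, hv.apply_eq_smul⟩
  · rintro ⟨v, hv₀, hv⟩
    exact Module.End.hasEigenvalue_of_hasEigenvector ⟨Module.End.mem_eigenspace_iff.2 hv, hv₀⟩

theorem spectrum_nonempty_of_isSelfAdjoint {E : Type*} [NormedAddCommGroup E]
    [InnerProductSpace ℝ E] [FiniteDimensional ℝ E] [Nontrivial E] {A : E →L[ℝ] E}
    (hA : IsSelfAdjoint A) : (spectrum ℝ A).Nonempty := by
  obtain ⟨b, l, hb⟩ := exists_eigenbasis hA
  have i : Fin (Module.finrank ℝ E) := ⟨0, Module.finrank_pos⟩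
  exact ⟨l i, mem_spectrum_iff_exists_eigenvector.2 ⟨b i, b.orthonormal.ne_zero i, hb i⟩⟩

variable {n : ℕ} {A B : Vec n →L[ℝ] Vec n}

theorem lambdaMin_mul_le (hA : IsSelfAdjoint A) (v : Vec n) :
    lambdaMin A * ‖v‖ ^ 2 ≤ inner ℝ v (A v) := by
  obtain ⟨b, l, hb⟩ := exists_eigenbasis hA
  have lambdaMin_le : ∀ i, lambdaMin A ≤ l i := fun i =>
    csInf_le (spectrum.isCompact A).bddBelow
      (mem_spectrum_iff_exists_eigenvector.2 ⟨b i, b.orthonormal.ne_zero i, hb i⟩)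
  rw [← b.sum_inner_mul_inner, ← b.sum_sq_norm_inner_right v, Finset.mul_sum]
  refine Finset.sum_le_sum fun i _ => ?_
  rw [inner_eigenbasis_apply hb, real_inner_comm, Real.norm_eq_abs, sq_abs, mul_left_comm, ← sq]
  exact mul_le_mul_of_nonneg_right (lambdaMin_le i) (sq_nonneg _)

variable [NeZero n]

theorem le_lambdaMin (hA : IsSelfAdjoint A) {c : ℝ}
    (h : ∀ v, c * ‖v‖ ^ 2 ≤ inner ℝ v (A v)) : c ≤ lambdaMin A := by
  refine le_csInf (spectrum_nonempty_of_isSelfAdjoint hA) fun r hr => ?_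
  obtain ⟨v, hv₀, hv⟩ := mem_spectrum_iff_exists_eigenvector.1 hr
  have hvr := h v
  rw [hv, real_inner_smul_right, real_inner_self_eq_norm_sq] at hvr
  exact le_of_mul_le_mul_right hvr (by positivity)

theorem lambdaMin_sub_norm_le (hA : IsSelfAdjoint A) (hB : IsSelfAdjoint B) :
    lambdaMin A - ‖A - B‖ ≤ lambdaMin B := by
  refine le_lambdaMin hB fun v => ?_
  have hAv := lambdaMin_mul_le hA v
  have hABv := le_of_abs_le (abs_inner_apply_le (A - B) v)
  rw [sub_apply, inner_sub_right] at hABv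
  linarith

theorem lipschitzOnWith_lambdaMin :
    LipschitzOnWith 1 (lambdaMin (n := n)) {A | IsSelfAdjoint A} := by
  refine LipschitzOnWith.of_dist_le_mul fun A hA B hB => ?_
  have hAB := lambdaMin_sub_norm_le hA hB
  have hBA := lambdaMin_sub_norm_le hB hA
  rw [norm_sub_rev] at hBA
  rw [Real.dist_eq, NNReal.coe_one, one_mul, dist_eq_norm, abs_le]
  constructor <;> linarith

theorem abs_lambdaMin_le (hA : IsSelfAdjoint A) : |lambdaMin A| ≤ ‖A‖ := by
  have := lipschitzOnWith_lambdaMin.dist_le_mul A hA 0 (IsSelfAdjoint.zero (Vec n →L[ℝ] Vec n))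
  have hzero : lambdaMin (0 : Vec n →L[ℝ] Vec n) = 0 := by
    rw [lambdaMin, spectrum.zero_eq, csInf_singleton]
  simpa [Real.dist_eq, hzero] using this

theorem measurable_lambdaMin {α : Type*} [MeasurableSpace α] {A : α → Vec n →L[ℝ] Vec n}
    (hA : Measurable A) (hsa : ∀ a, IsSelfAdjoint (A a)) :
    Measurable fun a => lambdaMin (A a) := by
  obtain ⟨g, hg, heq⟩ := (lipschitzOnWith_lambdaMin (n := n)).extend_real
  have : (fun a => lambdaMin (A a)) = fun a => g (A a) := funext fun a => heq (hsa a)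
  rw [this]
  exact hg.continuous.measurable.comp hA

end LambdaMin

section Step

variable {n k : ℕ} {F : Vec n → ℝ} {x d g : Vec n} {c Δ M R lam : ℝ}

section Multiplier

variable {B : Vec n →L[ℝ] Vec n}

theorem half_multiplier_mul_sq_le (hF : TwiceDifferentiable F)
    (hsm : ∀ y, ‖x - y‖ ≤ ‖d‖ → ‖hess F x - hess F y‖ ≤ M * ‖x - y‖)
    (hlam : g + B d = -(lam • d)) (hcurv : 0 ≤ inner ℝ d (B d) + lam * ‖d‖ ^ 2) :
    lam / 2 * ‖d‖ ^ 2 ≤ F x - F (x + d) + ‖g - gradient F x‖ * ‖d‖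
      + 1 / 2 * (‖(hess F x - B) d‖ * ‖d‖) + M / 6 * ‖d‖ ^ 3 := by
  have taylor := apply_add_le_of_norm_hess_sub_le hF hsm
  have hgrad := neg_le_of_abs_le (abs_real_inner_le_norm (g - gradient F x) d)
  have hhess : inner ℝ d (hess F x d) - inner ℝ d (B d) ≤ ‖(hess F x - B) d‖ * ‖d‖ := by
    rw [← inner_sub_right, ← sub_apply, mul_comm]
    exact real_inner_le_norm _ _
  have hcrit : inner ℝ (g + B d) d = -(lam * ‖d‖ ^ 2) := by
    rw [hlam, inner_neg_left, real_inner_smul_left, real_inner_self_eq_norm_sq]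
  rw [inner_sub_left] at hgrad
  rw [inner_add_left, real_inner_comm d (B d)] at hcrit
  linarith

theorem norm_gradient_add_le_of_multiplier (hF : Differentiable ℝ (gradient F))
    (hsm : ∀ y, ‖x - y‖ ≤ ‖d‖ → ‖hess F x - hess F y‖ ≤ M * ‖x - y‖)
    (hlam₀ : 0 ≤ lam) (hlam : g + B d = -(lam • d)) :
    ‖gradient F (x + d)‖
      ≤ M / 2 * ‖d‖ ^ 2 + ‖g - gradient F x‖ + ‖(hess F x - B) d‖ + lam * ‖d‖ :=
  calc ‖gradient F (x + d)‖
      = ‖gradient F (x + d) - gradient F x - hess F x d + (gradient F x - g)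
          + (hess F x - B) d + (g + B d)‖ := by rw [sub_apply]; abel_nf
    _ ≤ ‖gradient F (x + d) - gradient F x - hess F x d‖ + ‖gradient F x - g‖
          + ‖(hess F x - B) d‖ + ‖g + B d‖ := norm_add₄_le
    _ ≤ M / 2 * ‖d‖ ^ 2 + ‖g - gradient F x‖ + ‖(hess F x - B) d‖ + lam * ‖d‖ := by
        rw [hlam, norm_neg, norm_smul, Real.norm_of_nonneg hlam₀, norm_sub_rev g]
        gcongr
        exact norm_gradient_add_sub_sub_hess_le hF hsm

end Multiplier

variable {H : Vec n →L[ℝ] Vec n} {V : Matrix (Fin n) (Fin k) ℝ}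

theorem neg_lambdaMin_projected_hess_add_le [NeZero n] (hF : TwiceDifferentiable F)
    (hsm : ∀ y, ‖x - y‖ ≤ ‖d‖ → ‖hess F x - hess F y‖ ≤ M * ‖x - y‖) (hH : IsSelfAdjoint H)
    (hV : V.transpose * V = 1)
    (hcurv : ∀ v, 0 ≤ inner ℝ v (projected V H v) + lam * ‖v‖ ^ 2) :
    -lambdaMin (projected V (hess F (x + d))) ≤ lam + ‖H - hess F x‖ + M * ‖d‖ := by
  have hmodel : -lam ≤ lambdaMin (projected V H) :=
    le_lambdaMin (isSelfAdjoint_projected V hH) fun v => by linarith [hcurv v]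
  have hpert := lambdaMin_sub_norm_le (isSelfAdjoint_projected V hH)
    (isSelfAdjoint_projected V (isSelfAdjoint_hess hF (x + d)))
  have herr : ‖projected V H - projected V (hess F (x + d))‖ ≤ ‖H - hess F x‖ + M * ‖d‖ :=
    calc ‖projected V H - projected V (hess F (x + d))‖
        ≤ ‖H - hess F (x + d)‖ := by
          rw [← projected_sub]
          exact norm_projected_le hV _
      _ ≤ ‖H - hess F x‖ + ‖hess F x - hess F (x + d)‖ := norm_sub_le_norm_sub_add_norm_sub _ _ _
      _ ≤ ‖H - hess F x‖ + M * ‖d‖ := by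
          gcongr
          simpa using hsm (x + d) (by simp)
  linarith

/-- The amount by which inexact derivatives and higher-order terms can spoil the decrease of the
objective over one step: `a` and `b` are the errors of the gradient and Hessian estimates, and `ρ`
bounds the cubic remainder. -/
def stepError (Δ a b ρ : ℝ) : ℝ := 2 * (Δ * a + Δ ^ 2 * b + Δ ^ 3 * ρ)

theorem SolvesSubproblem.norm_gradient_and_neg_lambdaMin_le [NeZero n]
    (hF : TwiceDifferentiable F) (hΔ : 0 < Δ) (hM : 0 ≤ M) (hR : 0 ≤ R)
    (hsm : ∀ y, ‖x - y‖ ≤ Δ → ‖hess F x - hess F y‖ ≤ M * ‖x - y‖) (hH : IsSelfAdjoint H)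
    (hV : V.transpose * V = 1) (hd : SolvesSubproblem c g (projected V H) Δ d)
    (hin : ‖(hess F x - projected V (hess F x)) d‖ ≤ R * ‖d‖ ^ 2) :
    Δ / 2 * ‖gradient F (x + d)‖ ≤ F x - F (x + d)
        + stepError Δ ‖g - gradient F x‖ ‖H - hess F x‖ (M + R) ∧
      Δ ^ 2 / 2 * -lambdaMin (projected V (hess F (x + d))) ≤ F x - F (x + d)
        + stepError Δ ‖g - gradient F x‖ ‖H - hess F x‖ (M + R) := by
  obtain ⟨lam, hlam₀, hlam, hcompl, hcurv⟩ :=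
    hd.exists_multiplier (isSelfAdjoint_projected V hH) hΔ
  have hdΔ : ‖d‖ ≤ Δ := hd.1
  have hloc : ∀ y, ‖x - y‖ ≤ ‖d‖ → ‖hess F x - hess F y‖ ≤ M * ‖x - y‖ :=
    fun y hy => hsm y (hy.trans hdΔ)
  set a := ‖g - gradient F x‖
  set b := ‖H - hess F x‖
  have hbias : ‖(hess F x - projected V H) d‖ ≤ R * Δ ^ 2 + b * Δ :=
    (norm_sub_projected_apply_le hV _ _ _).trans
      (add_le_add (hin.trans (by gcongr)) (by gcongr))
  have hdec : lam / 2 * Δ ^ 2 ≤ F x - F (x + d) + a * Δ + 1 / 2 * ((R * Δ ^ 2 + b * Δ) * Δ)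
      + M / 6 * Δ ^ 3 :=
    calc lam / 2 * Δ ^ 2 = lam / 2 * ‖d‖ ^ 2 := by linear_combination -(‖d‖ + Δ) / 2 * hcompl
      _ ≤ _ := half_multiplier_mul_sq_le hF hloc hlam (hcurv d)
      _ ≤ _ := by gcongr
  have hgrad : ‖gradient F (x + d)‖ ≤ M / 2 * Δ ^ 2 + a + (R * Δ ^ 2 + b * Δ) + lam * Δ :=
    (norm_gradient_add_le_of_multiplier hF.2 hloc hlam₀ hlam).trans (by gcongr)
  have heig : -lambdaMin (projected V (hess F (x + d))) ≤ lam + b + M * Δ :=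
    (neg_lambdaMin_projected_hess_add_le hF hloc hH hV hcurv).trans (by gcongr)
  have ha_nonneg : 0 ≤ Δ * a := by positivity
  have hb_nonneg : 0 ≤ Δ ^ 2 * b := by positivity
  have hM_nonneg : 0 ≤ Δ ^ 3 * M := by positivity
  have hR_nonneg : 0 ≤ Δ ^ 3 * R := by positivity
  unfold stepError
  constructor
  · linarith [mul_le_mul_of_nonneg_left hgrad (by positivity : 0 ≤ Δ / 2)]
  · linarith [mul_le_mul_of_nonneg_left heig (by positivity : 0 ≤ Δ ^ 2 / 2)]

end Step

section Measurability

theorem measurable_fderiv_apply_uncurry {X E Ξ : Type*} [NormedAddCommGroup X] [NormedSpace ℝ X]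
    [MeasurableSpace X] [BorelSpace X] [NormedAddCommGroup E] [NormedSpace ℝ E]
    [MeasurableSpace E] [BorelSpace E] [SecondCountableTopology E] [MeasurableSpace Ξ]
    {f : X → Ξ → E} (hf : Measurable (Function.uncurry f))
    (hd : ∀ ξ, Differentiable ℝ fun x => f x ξ) (v : X) :
    Measurable fun p : X × Ξ => fderiv ℝ (fun y => f y p.2) p.1 v := by
  refine measurable_of_tendsto_metrizable (f := fun (j : ℕ) (p : X × Ξ) =>
    (j : ℝ) • (f (p.1 + (j : ℝ)⁻¹ • v) p.2 - f p.1 p.2)) (fun j => ?_) ?_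
  · have hshift : Measurable fun p : X × Ξ => (p.1 + (j : ℝ)⁻¹ • v, p.2) := by fun_prop
    exact ((hf.comp hshift).sub hf).const_smul (j : ℝ)
  · refine tendsto_pi_nhds.2 fun p => (hd p.2 p.1).hasFDerivAt.lim v ?_
    simpa using tendsto_natCast_atTop_atTop

variable {E : Type*} [NormedAddCommGroup E] [InnerProductSpace ℝ E] [FiniteDimensional ℝ E]

theorem measurable_gradient_uncurry [MeasurableSpace E] [BorelSpace E] {Ξ : Type*}
    [MeasurableSpace Ξ] {f : E → Ξ → ℝ} (hf : Measurable (Function.uncurry f))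
    (hd : ∀ ξ, Differentiable ℝ fun x => f x ξ) :
    Measurable (Function.uncurry fun x ξ => gradient (fun y => f y ξ) x) := by
  let u := stdOrthonormalBasis ℝ E
  have hexpand : (Function.uncurry fun x ξ => gradient (fun y => f y ξ) x) = fun p : E × Ξ =>
      ∑ i, fderiv ℝ (fun y => f y p.2) p.1 (u i) • u i := by
    funext p
    simp only [← inner_gradient_left, real_inner_comm (u _)]
    exact (u.sum_repr' _).symm
  rw [hexpand]
  exact Finset.measurable_sum _ fun i _ => (measurable_fderiv_apply_uncurry hf hd _).smul_const _

theorem measurable_clm_of_apply {F α : Type*} [NormedAddCommGroup F] [NormedSpace ℝ F]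
    [FiniteDimensional ℝ F] [MeasurableSpace F] [BorelSpace F] [MeasurableSpace α]
    {A : α → E →L[ℝ] F} (hA : ∀ v, Measurable fun a => A a v) : Measurable A := by
  let u := stdOrthonormalBasis ℝ E
  have hexpand : A = fun a => ∑ i, ContinuousLinearMap.smulRightL ℝ E F
      (innerSL ℝ (u i)) (A a (u i)) := by
    funext a
    ext1 v
    conv_lhs => rw [← u.sum_repr' v, map_sum]
    simp only [map_smul, sum_apply, ContinuousLinearMap.smulRightL_apply_apply,
      ContinuousLinearMap.smulRight_apply, innerSL_apply_apply]
  rw [hexpand]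
  exact Finset.measurable_sum _ fun i _ =>
    (ContinuousLinearMap.continuous _).measurable.comp (hA _)

variable {n k : ℕ}

theorem measurable_hess_uncurry {Ξ : Type*} [MeasurableSpace Ξ] {f : Vec n → Ξ → ℝ}
    (hf : Measurable (Function.uncurry f)) (hd : ∀ ξ, TwiceDifferentiable fun x => f x ξ) :
    Measurable (Function.uncurry fun x ξ => hess (fun y => f y ξ) x) :=
  measurable_clm_of_apply fun v =>
    measurable_fderiv_apply_uncurry (measurable_gradient_uncurry hf fun ξ => (hd ξ).1)
      (fun ξ => (hd ξ).2) v

variable {α : Type*} [MeasurableSpace α] {V : α → Matrix (Fin n) (Fin k) ℝ}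

theorem measurable_proj (hV : ∀ i j, Measurable fun a => V a i j) :
    Measurable fun a => proj (V a) := by
  refine measurable_clm_of_apply fun v => ?_
  change Measurable fun a => WithLp.toLp 2 ((V a * (V a).transpose).mulVec (WithLp.ofLp v))
  refine (WithLp.measurable_toLp 2 _).comp (measurable_pi_lambda _ fun i => ?_)
  simp only [Matrix.mulVec, dotProduct, Matrix.mul_apply, Matrix.transpose_apply]
  fun_prop

theorem measurable_projected (hV : ∀ i j, Measurable fun a => V a i j)
    {A : α → Vec n →L[ℝ] Vec n} (hA : Measurable A) :
    Measurable fun a => projected (V a) (A a) :=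
  ((measurable_proj hV).mul hA).mul (measurable_proj hV)

end Measurability

section BatchDerivatives

variable {n m : ℕ} {Ξ : Type*} {f : Vec n → Ξ → ℝ}

theorem hasGradientAt_batch (hd : ∀ ξ, Differentiable ℝ fun x => f x ξ) (S : Fin m → Ξ)
    (x : Vec n) :
    HasGradientAt (batch f S) (sampleMean (fun ξ => gradient (fun y => f y ξ) x) S) x := by
  rw [hasGradientAt_iff_hasFDerivAt, sampleMean, map_smul, map_sum]
  exact (HasFDerivAt.fun_sum fun i _ => (hd (S i) x).hasGradientAt.hasFDerivAt).const_mul _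

theorem gradient_batch (hd : ∀ ξ, Differentiable ℝ fun x => f x ξ) (S : Fin m → Ξ) :
    gradient (batch f S) = fun x => sampleMean (fun ξ => gradient (fun y => f y ξ) x) S :=
  funext fun x => (hasGradientAt_batch hd S x).gradient

theorem hasFDerivAt_gradient_batch (hd : ∀ ξ, TwiceDifferentiable fun x => f x ξ)
    (S : Fin m → Ξ) (x : Vec n) :
    HasFDerivAt (gradient (batch f S)) (sampleMean (fun ξ => hess (fun y => f y ξ) x) S) x := by
  rw [gradient_batch fun ξ => (hd ξ).1]
  exact (HasFDerivAt.fun_sum fun i _ => ((hd (S i)).2 x).hasFDerivAt).const_smul (m : ℝ)⁻¹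

theorem hess_batch (hd : ∀ ξ, TwiceDifferentiable fun x => f x ξ) (S : Fin m → Ξ) (x : Vec n) :
    hess (batch f S) x = sampleMean (fun ξ => hess (fun y => f y ξ) x) S :=
  (hasFDerivAt_gradient_batch hd S x).fderiv

theorem isSelfAdjoint_hess_batch (hd : ∀ ξ, TwiceDifferentiable fun x => f x ξ) (S : Fin m → Ξ)
    (x : Vec n) : IsSelfAdjoint (hess (batch f S) x) :=
  isSelfAdjoint_hess
    ⟨fun y => (hasGradientAt_batch (fun ξ => (hd ξ).1) S y).differentiableAt,
      fun y => (hasFDerivAt_gradient_batch hd S y).differentiableAt⟩ x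

variable [MeasurableSpace Ξ]

theorem measurable_sampleMean_uncurry {X E : Type*} [MeasurableSpace X] [NormedAddCommGroup E]
    [NormedSpace ℝ E] [MeasurableSpace E] [BorelSpace E] [SecondCountableTopology E]
    {Z : X → Ξ → E} (hZ : Measurable (Function.uncurry Z)) :
    Measurable fun p : X × (Fin m → Ξ) => sampleMean (Z p.1) p.2 := by
  have hsample : ∀ i, Measurable fun p : X × (Fin m → Ξ) => (p.1, p.2 i) := by fun_prop
  exact (Finset.measurable_sum _ fun i _ => hZ.comp (hsample i)).const_smul (m : ℝ)⁻¹

theorem measurable_gradient_batch (hf : Measurable (Function.uncurry f))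
    (hd : ∀ ξ, Differentiable ℝ fun x => f x ξ) :
    Measurable fun p : Vec n × (Fin m → Ξ) => gradient (batch f p.2) p.1 := by
  simp only [gradient_batch hd]
  exact measurable_sampleMean_uncurry (measurable_gradient_uncurry hf hd)

theorem measurable_hess_batch (hf : Measurable (Function.uncurry f))
    (hd : ∀ ξ, TwiceDifferentiable fun x => f x ξ) :
    Measurable fun p : Vec n × (Fin m → Ξ) => hess (batch f p.2) p.1 := by
  simp only [hess_batch hd]
  exact measurable_sampleMean_uncurry (measurable_hess_uncurry hf hd)

end BatchDerivatives

section BatchErrors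

theorem sqrt_sq_add_sq_mul_sq_le {p q r : ℝ} (hp : 0 ≤ p) (hq : 0 ≤ q) (hr : 0 ≤ r) :
    Real.sqrt (p ^ 2 + q ^ 2 * r ^ 2) ≤ p + q * r := by
  refine (Real.sqrt_le_left (by positivity)).2 ?_
  linarith [mul_nonneg hp (mul_nonneg hq hr)]

variable {n m : ℕ} {Ξ : Type*} [MeasurableSpace Ξ] {P : Measure Ξ} [IsProbabilityMeasure P]
  {f : Vec n → Ξ → ℝ} {Δ : ℝ}

theorem lintegral_gradient_batch_sub_le {G₀ G₁ : ℝ} (hG₀ : 0 ≤ G₀) (hG₁ : 0 ≤ G₁)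
    (hf : Measurable (Function.uncurry f)) (hd : ∀ ξ, Differentiable ℝ fun x => f x ξ)
    (hvar : BoundedGradientVariance P f G₀ G₁) (hΔ : 0 < Δ) (hm : (Δ ^ 4)⁻¹ ≤ m) (x : Vec n) :
    ∫⁻ S : Fin m → Ξ, ‖gradient (batch f S) x - gradient (objective P f) x‖ₑ
        ∂(Measure.pi fun _ => P)
      ≤ ENNReal.ofReal (Δ ^ 2 * (G₀ + G₁ * ‖gradient (objective P f) x‖)) := by
  obtain ⟨hint, hmean, hint_sq, hle⟩ := hvar x
  have hZ : Measurable fun ξ => gradient (fun y => f y ξ) x :=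
    (measurable_gradient_uncurry hf hd).comp measurable_prodMk_left
  have hm₀ : (0 : ℝ) < m := lt_of_lt_of_le (by positivity) hm
  have hinv : (m : ℝ)⁻¹ ≤ Δ ^ 4 := inv_le_of_inv_le₀ (by positivity) hm
  simp only [gradient_batch hd]
  refine ((UnbiasedEstimate.mk hZ hint hmean hint_sq hle).lintegral_sampleMean_sub_le_sqrt_div
    (by exact_mod_cast hm₀)).trans (ENNReal.ofReal_le_ofReal ?_)
  calc Real.sqrt ((G₀ ^ 2 + G₁ ^ 2 * ‖gradient (objective P f) x‖ ^ 2) / m)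
      ≤ Real.sqrt ((Δ ^ 2) ^ 2 * (G₀ ^ 2 + G₁ ^ 2 * ‖gradient (objective P f) x‖ ^ 2)) := by
        rw [div_eq_mul_inv, mul_comm]
        gcongr
        exact hinv.trans_eq (by ring)
    _ = Δ ^ 2 * Real.sqrt (G₀ ^ 2 + G₁ ^ 2 * ‖gradient (objective P f) x‖ ^ 2) := by
        rw [Real.sqrt_mul (by positivity), Real.sqrt_sq (by positivity)]
    _ ≤ _ := by
        gcongr
        exact sqrt_sq_add_sq_mul_sq_le hG₀ hG₁ (norm_nonneg _)

theorem lintegral_hess_batch_sub_le {K₀ K₁ : ℝ} (hn : 2 ≤ n) (hK₀ : 0 ≤ K₀) (hK₁ : 0 ≤ K₁)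
    (hf : Measurable (Function.uncurry f)) (hd : ∀ ξ, TwiceDifferentiable fun x => f x ξ)
    (hF : TwiceDifferentiable (objective P f)) (hvar : BoundedHessianVariance P f K₀ K₁)
    (hΔ : 0 < Δ) (hm : 22 * Real.log n * (Δ ^ 2)⁻¹ ≤ m) (x : Vec n) :
    ∫⁻ S : Fin m → Ξ, ‖hess (batch f S) x - hess (objective P f) x‖ₑ ∂(Measure.pi fun _ => P)
      ≤ ENNReal.ofReal (Δ * (1 + K₀ + K₁ * ‖gradient (objective P f) x‖)) := by
  obtain ⟨hint, hmean, hint_sq, hle⟩ := hvar x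
  have hZ : Measurable fun ξ => hess (fun y => f y ξ) x :=
    (measurable_hess_uncurry hf hd).comp measurable_prodMk_left
  have hfin : Module.finrank ℝ (Vec n) = n := finrank_euclideanSpace_fin
  simp only [hess_batch hd]
  refine ((UnbiasedEstimate.mk hZ hint hmean hint_sq hle).lintegral_opNorm_sampleMean_sub_le
    (by rwa [hfin]) (fun ξ => isSelfAdjoint_hess (hd ξ) x) (isSelfAdjoint_hess hF x)
    (by positivity : 0 < Δ ^ 2) (by rwa [hfin])).trans (ENNReal.ofReal_le_ofReal ?_)
  rw [Real.sqrt_mul (by positivity), Real.sqrt_sq hΔ.le]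
  gcongr
  refine (Real.sqrt_le_left (by positivity)).2 ?_
  have hcross : 0 ≤ K₁ * ‖gradient (objective P f) x‖ := by positivity
  linarith [mul_nonneg hK₀ hcross]

end BatchErrors

section Independence

variable {Ω : Type*} [MeasurableSpace Ω] {μ : Measure Ω}

theorem integrable_norm_and_integral_norm_le_of_map_prodMk {α β E : Type*} [MeasurableSpace α]
    [MeasurableSpace β] [NormedAddCommGroup E] [MeasurableSpace E] [OpensMeasurableSpace E]
    [SecondCountableTopology E] {ν : Measure β} [SFinite ν] {X : Ω → α} {S : Ω → β}
    (hX : Measurable X) (hS : Measurable S)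
    (hlaw : μ.map (fun ω => (X ω, S ω)) = (μ.map X).prod ν) {φ : α × β → E} (hφ : Measurable φ)
    {c : α → ℝ} (hc : Measurable c) (hc_nonneg : ∀ x, 0 ≤ c x)
    (hφc : ∀ x, ∫⁻ s, ‖φ (x, s)‖ₑ ∂ν ≤ ENNReal.ofReal (c x))
    (hcX : Integrable (fun ω => c (X ω)) μ) :
    Integrable (fun ω => ‖φ (X ω, S ω)‖) μ ∧
      ∫ ω, ‖φ (X ω, S ω)‖ ∂μ ≤ ∫ ω, c (X ω) ∂μ := by
  have hcX_nonneg : 0 ≤ ∫ ω, c (X ω) ∂μ := integral_nonneg fun ω => hc_nonneg _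
  have hle : ∫⁻ ω, ‖φ (X ω, S ω)‖ₑ ∂μ ≤ ENNReal.ofReal (∫ ω, c (X ω) ∂μ) :=
    calc ∫⁻ ω, ‖φ (X ω, S ω)‖ₑ ∂μ = ∫⁻ x, ∫⁻ s, ‖φ (x, s)‖ₑ ∂ν ∂(μ.map X) := by
          rw [← lintegral_prod _ hφ.enorm.aemeasurable, ← hlaw,
            lintegral_map hφ.enorm (hX.prodMk hS)]
      _ ≤ ∫⁻ x, ENNReal.ofReal (c x) ∂(μ.map X) := lintegral_mono hφc
      _ = ENNReal.ofReal (∫ ω, c (X ω) ∂μ) := by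
          rw [lintegral_map hc.ennreal_ofReal hX,
            ofReal_integral_eq_lintegral_ofReal hcX (.of_forall fun ω => hc_nonneg _)]
  have hint : Integrable (fun ω => φ (X ω, S ω)) μ :=
    ⟨(hφ.comp (hX.prodMk hS)).aestronglyMeasurable, hle.trans_lt ENNReal.ofReal_lt_top⟩
  refine ⟨hint.norm, (ENNReal.ofReal_le_ofReal_iff hcX_nonneg).1 ?_⟩
  rwa [ofReal_integral_norm_eq_lintegral_enorm hint]

theorem map_prodMk_eq_of_indep [IsProbabilityMeasure μ] {α Ξ : Type*} [MeasurableSpace α]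
    [MeasurableSpace Ξ] {P : Measure Ξ} {m : ℕ} {X : Ω → α} {S : Fin m → Ω → Ξ} (hX : Measurable X)
    (hS : ∀ i, Measurable (S i)) (hlaw : ∀ i, μ.map (S i) = P) (hind : iIndepFun S μ)
    (hfresh : IndepFun X (fun ω i => S i ω) μ) :
    μ.map (fun ω => (X ω, fun i => S i ω)) = (μ.map X).prod (Measure.pi fun _ => P) := by
  rw [(indepFun_iff_map_prod_eq_prod_map_map hX.aemeasurable
      (measurable_pi_lambda _ hS).aemeasurable).1 hfresh,
    (iIndepFun_iff_map_fun_eq_pi_map fun i => (hS i).aemeasurable).1 hind]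
  simp only [hlaw]

end Independence

section Run

variable {n k : ℕ} {Ξ Ω : Type*} [MeasurableSpace Ξ] [mΩ : MeasurableSpace Ω] {P : Measure Ξ}
  {f : Vec n → Ξ → ℝ} {μ : Measure Ω} {ℱ : Filtration ℕ mΩ} {x₀ : Vec n}
  {Δ : ℝ} {T m₁ m₂ : ℕ} {S₁ : ℕ → Fin m₁ → Ω → Ξ} {S₂ : ℕ → Fin m₂ → Ω → Ξ}
  {V : ℕ → Ω → Matrix (Fin n) (Fin k) ℝ} {x d : ℕ → Ω → Vec n} {L₀ L₁ : ℝ} {t : ℕ}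

theorem IsRun.measurable_iterate (h : IsRun P f μ ℱ x₀ Δ T m₁ m₂ S₁ S₂ V x d) (ht : t ≤ T) :
    Measurable (x t) := (h.iterate_meas t ht).mono (ℱ.le t) le_rfl

theorem IsRun.measurable_sample₁ (h : IsRun P f μ ℱ x₀ Δ T m₁ m₂ S₁ S₂ V x d) (ht : t < T)
    (i : Fin m₁) : Measurable (S₁ t i) := (h.sample₁_meas t ht i).mono (ℱ.le _) le_rfl

theorem IsRun.measurable_sample₂ (h : IsRun P f μ ℱ x₀ Δ T m₁ m₂ S₁ S₂ V x d) (ht : t < T)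
    (i : Fin m₂) : Measurable (S₂ t i) := (h.sample₂_meas t ht i).mono (ℱ.le _) le_rfl

theorem IsRun.indepFun_iterate_batches (h : IsRun P f μ ℱ x₀ Δ T m₁ m₂ S₁ S₂ V x d) (ht : t < T) :
    IndepFun (x t) (fun ω => ((fun i => S₁ t i ω, fun j => S₂ t j ω) :
      (Fin m₁ → Ξ) × (Fin m₂ → Ξ))) μ := by
  rw [IndepFun_iff_Indep]
  exact (indep_of_indep_of_le_right (h.sample_fresh t ht)
    (h.iterate_meas t ht.le).comap_le).symm

theorem IsRun.map_iterate_batch₁ [IsProbabilityMeasure μ]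
    (h : IsRun P f μ ℱ x₀ Δ T m₁ m₂ S₁ S₂ V x d) (ht : t < T) :
    μ.map (fun ω => (x t ω, fun i => S₁ t i ω))
      = (μ.map (x t)).prod (Measure.pi fun _ => P) :=
  map_prodMk_eq_of_indep (h.measurable_iterate ht.le) (h.measurable_sample₁ ht)
    (h.sample₁_law t ht) (.precomp (g := Sum.inl) Sum.inl_injective (h.sample_indep t ht))
    ((h.indepFun_iterate_batches ht).comp measurable_id measurable_fst)

theorem IsRun.map_iterate_batch₂ [IsProbabilityMeasure μ]
    (h : IsRun P f μ ℱ x₀ Δ T m₁ m₂ S₁ S₂ V x d) (ht : t < T) :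
    μ.map (fun ω => (x t ω, fun i => S₂ t i ω))
      = (μ.map (x t)).prod (Measure.pi fun _ => P) :=
  map_prodMk_eq_of_indep (h.measurable_iterate ht.le) (h.measurable_sample₂ ht)
    (h.sample₂_law t ht) (.precomp (g := Sum.inr) Sum.inr_injective (h.sample_indep t ht))
    ((h.indepFun_iterate_batches ht).comp measurable_id measurable_snd)

theorem IsRun.norm_gradient_add_le (h : IsRun P f μ ℱ x₀ Δ T m₁ m₂ S₁ S₂ V x d)
    (hL₀ : 0 ≤ L₀) (hL₁ : 0 ≤ L₁) (hΔ : L₁ * Δ ≤ 1)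
    (hF : GeneralizedSmooth (objective P f) L₀ L₁) (ht : t ≤ T) (ω : Ω) :
    ‖gradient (objective P f) (x t ω)‖ + L₀ * Δ
      ≤ 2 ^ t * (‖gradient (objective P f) x₀‖ + L₀ * Δ) := by
  induction t with
  | zero => simp [h.start ω]
  | succ t ih =>
    have hstep := hF.norm_gradient_add_le hL₀ hL₁ hΔ (x := x t ω) (h.step t ht ω).1
    rw [h.update t ht ω, pow_succ]
    linarith [ih (by omega)]

theorem IsRun.integrable_norm_gradient [IsFiniteMeasure μ]
    (h : IsRun P f μ ℱ x₀ Δ T m₁ m₂ S₁ S₂ V x d) (hL₀ : 0 ≤ L₀) (hL₁ : 0 ≤ L₁) (hΔ₀ : 0 ≤ Δ)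
    (hΔ : L₁ * Δ ≤ 1) (hF : GeneralizedSmooth (objective P f) L₀ L₁)
    (hF₂ : Continuous (gradient (objective P f))) (ht : t ≤ T) :
    Integrable (fun ω => ‖gradient (objective P f) (x t ω)‖) μ := by
  refine .of_bound (C := 2 ^ t * (‖gradient (objective P f) x₀‖ + L₀ * Δ))
    (hF₂.norm.measurable.comp (h.measurable_iterate ht)).aestronglyMeasurable
    (.of_forall fun ω => ?_)
  have hLΔ : 0 ≤ L₀ * Δ := by positivity
  rw [norm_norm]
  linarith [h.norm_gradient_add_le hL₀ hL₁ hΔ hF ht ω]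

theorem IsRun.abs_lambdaMin_le [NeZero n] (h : IsRun P f μ ℱ x₀ Δ T m₁ m₂ S₁ S₂ V x d)
    (hL₀ : 0 ≤ L₀) (hL₁ : 0 ≤ L₁) (hF : GeneralizedSmooth (objective P f) L₀ L₁)
    (hF₂ : TwiceDifferentiable (objective P f)) (ht : t < T) (ω : Ω) :
    |lambdaMin (projected (V t ω) (hess (objective P f) (x (t + 1) ω)))|
      ≤ L₀ + L₁ * ‖gradient (objective P f) (x (t + 1) ω)‖ :=
  calc |lambdaMin (projected (V t ω) (hess (objective P f) (x (t + 1) ω)))|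
      ≤ ‖projected (V t ω) (hess (objective P f) (x (t + 1) ω))‖ :=
        TrustRegion.abs_lambdaMin_le (isSelfAdjoint_projected _ (isSelfAdjoint_hess hF₂ _))
    _ ≤ ‖hess (objective P f) (x (t + 1) ω)‖ := norm_projected_le (h.basis_orthonormal t ht ω) _
    _ ≤ _ := hF.norm_hess_le hL₀ hL₁ hF₂ _

theorem IsRun.measurable_lambdaMin [NeZero n] (h : IsRun P f μ ℱ x₀ Δ T m₁ m₂ S₁ S₂ V x d)
    (hF₂ : TwiceDifferentiable (objective P f)) (hc : Continuous (hess (objective P f)))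
    (ht : t < T) :
    Measurable fun ω => lambdaMin (projected (V t ω) (hess (objective P f) (x (t + 1) ω))) :=
  TrustRegion.measurable_lambdaMin
    (measurable_projected (fun i j => (h.basis_meas t ht i j).mono (ℱ.le _) le_rfl)
      (hc.measurable.comp (h.measurable_iterate ht)))
    fun _ => isSelfAdjoint_projected _ (isSelfAdjoint_hess hF₂ _)

end Run

section UniformIndex

theorem uniformOn_Iio_eq_sum_dirac (T : ℕ) :
    uniformOn (Set.Iio T) = (T : ENNReal)⁻¹ • ∑ t ∈ Finset.range T, Measure.dirac t := by
  refine Measure.ext_of_singleton fun s => ?_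
  have hcard : Measure.count (Set.Iio T) = (T : ENNReal) := by
    rw [← Finset.coe_Iio, Measure.count_apply_finset, Nat.card_Iio]
  rw [uniformOn, cond_apply measurableSet_Iio, hcard]
  rcases lt_or_ge s T with hs | hs
  · have hinter : Set.Iio T ∩ {s} = {s} := by ext; simp; omega
    simp [hinter, hs, Set.indicator_apply]
  · have hinter : Set.Iio T ∩ {s} = ∅ := by ext; simp; omega
    simp [hinter, hs, Set.indicator_apply]

variable {Ω : Type*} [MeasurableSpace Ω] {μ : Measure Ω} {T : ℕ} {u : ℕ → Ω → ℝ}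

theorem integrable_map_prodMk (hu : ∀ t < T, Integrable (u t) μ) :
    ∀ t ∈ Finset.range T, Integrable (fun p : ℕ × Ω => u p.1 p.2) (μ.map (Prod.mk t)) :=
  fun t ht => (measurableEmbedding_prodMk_left t).integrable_map_iff.2
    (hu t (Finset.mem_range.1 ht))

variable [SFinite μ]

theorem withUniformIndex_eq_sum_map (T : ℕ) :
    withUniformIndex T μ = (T : ENNReal)⁻¹ • ∑ t ∈ Finset.range T, μ.map (Prod.mk t) := by
  rw [withUniformIndex, uniformOn_Iio_eq_sum_dirac, Measure.prod_smul_left]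
  congr 1
  induction T with
  | zero => simp
  | succ T ih =>
    rw [Finset.sum_range_succ, Finset.sum_range_succ, Measure.add_prod, ih, Measure.dirac_prod]

theorem integrable_withUniformIndex (hT : 0 < T) (hu : ∀ t < T, Integrable (u t) μ) :
    Integrable (fun p : ℕ × Ω => u p.1 p.2) (withUniformIndex T μ) := by
  rw [withUniformIndex_eq_sum_map]
  exact (integrable_finsetSum_measure.2 (integrable_map_prodMk hu)).smul_measure
    (by simp [hT.ne'])

theorem integral_withUniformIndex (hu : ∀ t < T, Integrable (u t) μ) :
    ∫ p : ℕ × Ω, u p.1 p.2 ∂(withUniformIndex T μ)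
      = (T : ℝ)⁻¹ * ∑ t ∈ Finset.range T, ∫ ω, u t ω ∂μ := by
  rw [withUniformIndex_eq_sum_map, integral_smul_measure,
    integral_finsetSum_measure (integrable_map_prodMk hu)]
  simp [(measurableEmbedding_prodMk_left _).integral_map]

theorem integral_withUniformIndex_le_of_le [IsProbabilityMeasure μ] {B : ℝ} (hT : 0 < T)
    (hu : ∀ t < T, Integrable (u t) μ) (hB : ∀ t < T, ∀ ω, u t ω ≤ B) :
    ∫ p : ℕ × Ω, u p.1 p.2 ∂(withUniformIndex T μ) ≤ B := by
  have hmean : ∀ t ∈ Finset.range T, ∫ ω, u t ω ∂μ ≤ B := fun t ht => by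
    have hlt := Finset.mem_range.1 ht
    simpa using integral_mono (hu t hlt) (integrable_const B) (hB t hlt)
  rw [integral_withUniformIndex hu, inv_mul_le_iff₀ (by exact_mod_cast hT)]
  exact (Finset.sum_le_card_nsmul _ _ B hmean).trans_eq (by simp)

end UniformIndex

section StepErrorIntegral

variable {Ω : Type*} [MeasurableSpace Ω] {μ : Measure Ω} {u v w : Ω → ℝ}

theorem integrable_stepError (hu : Integrable u μ) (hv : Integrable v μ) (hw : Integrable w μ)
    (Δ : ℝ) : Integrable (fun ω => stepError Δ (u ω) (v ω) (w ω)) μ :=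
  (((hu.const_mul _).add (hv.const_mul _)).add (hw.const_mul _)).const_mul 2

theorem integral_stepError (hu : Integrable u μ) (hv : Integrable v μ) (hw : Integrable w μ)
    (Δ : ℝ) : ∫ ω, stepError Δ (u ω) (v ω) (w ω) ∂μ
      = stepError Δ (∫ ω, u ω ∂μ) (∫ ω, v ω ∂μ) (∫ ω, w ω ∂μ) := by
  have huv : Integrable (fun ω => Δ * u ω + Δ ^ 2 * v ω) μ :=
    (hu.const_mul _).add (hv.const_mul _)
  simp only [stepError]
  rw [integral_const_mul, integral_add huv (hw.const_mul _),
    integral_add (hu.const_mul _) (hv.const_mul _)]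
  simp only [integral_const_mul]

theorem stepError_le_stepError {Δ a a' b b' ρ : ℝ} (hΔ : 0 ≤ Δ) (ha : a ≤ a') (hb : b ≤ b') :
    stepError Δ a b ρ ≤ stepError Δ a' b' ρ := by
  unfold stepError
  gcongr

variable [IsProbabilityMeasure μ]

theorem integral_const_add_const_mul (hu : Integrable u μ) (p q : ℝ) :
    ∫ ω, (p + q * u ω) ∂μ = p + q * ∫ ω, u ω ∂μ := by
  rw [integral_add (integrable_const p) (hu.const_mul q), integral_const_mul, integral_const,
    probReal_univ, one_smul]

theorem sum_integral_le_of_ae_le_sub_add {T : ℕ} {D : ℝ} {F U E : ℕ → Ω → ℝ}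
    (hF : ∀ ω, F 0 ω - F T ω ≤ D) (hU : ∀ t < T, Integrable (U t) μ)
    (hE : ∀ t < T, Integrable (E t) μ)
    (hdec : ∀ t < T, ∀ᵐ ω ∂μ, U t ω ≤ F t ω - F (t + 1) ω + E t ω) :
    ∑ t ∈ Finset.range T, ∫ ω, U t ω ∂μ ≤ D + ∑ t ∈ Finset.range T, ∫ ω, E t ω ∂μ := by
  have hU' : ∀ t ∈ Finset.range T, Integrable (U t) μ := fun t ht => hU t (Finset.mem_range.1 ht)
  have hE' : ∀ t ∈ Finset.range T, Integrable (E t) μ := fun t ht => hE t (Finset.mem_range.1 ht)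
  have hall : ∀ᵐ ω ∂μ, ∀ t ∈ Finset.range T, U t ω ≤ F t ω - F (t + 1) ω + E t ω := by
    rw [Finset.eventually_all]
    exact fun t ht => hdec t (Finset.mem_range.1 ht)
  have htelescope : ∀ᵐ ω ∂μ, ∑ t ∈ Finset.range T, U t ω ≤ D + ∑ t ∈ Finset.range T, E t ω := by
    filter_upwards [hall] with ω hω
    have hsum := Finset.sum_le_sum hω
    rw [Finset.sum_add_distrib, Finset.sum_range_sub'] at hsum
    linarith [hF ω]
  calc ∑ t ∈ Finset.range T, ∫ ω, U t ω ∂μ = ∫ ω, ∑ t ∈ Finset.range T, U t ω ∂μ :=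
        (integral_finsetSum _ hU').symm
    _ ≤ ∫ ω, (D + ∑ t ∈ Finset.range T, E t ω) ∂μ :=
        integral_mono_ae (integrable_finsetSum _ hU')
          ((integrable_const _).add (integrable_finsetSum _ hE')) htelescope
    _ = D + ∑ t ∈ Finset.range T, ∫ ω, E t ω ∂μ := by
        rw [integral_add (integrable_const _) (integrable_finsetSum _ hE'),
          integral_finsetSum _ hE', integral_const, probReal_univ, one_smul]

end StepErrorIntegral

section Constants

/-- The constants of the smoothness assumptions (`L₀`, `L₁`, `δ`, `M₀`, `M₁`), of the variance
bounds for the gradient and the Hessian (`G₀`, `G₁`, `K₀`, `K₁`) and of the inexactness condition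
on the subspaces (`C₀`, `C₁`). -/
structure Constants where
  (L₀ L₁ G₀ G₁ δ M₀ M₁ K₀ K₁ C₀ C₁ : ℝ)
  L₀_pos : 0 < L₀
  L₁_nonneg : 0 ≤ L₁
  G₀_nonneg : 0 ≤ G₀
  G₁_nonneg : 0 ≤ G₁
  δ_pos : 0 < δ
  M₀_nonneg : 0 ≤ M₀
  M₁_nonneg : 0 ≤ M₁
  K₀_nonneg : 0 ≤ K₀
  K₁_nonneg : 0 ≤ K₁
  C₀_nonneg : 0 ≤ C₀
  C₁_nonneg : 0 ≤ C₁

namespace Constants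

/-- The part of the expected step error, in units of `Δ³`, that does not involve the gradient. -/
def errorOffset (c : Constants) : ℝ := 2 * (1 + c.G₀ + c.K₀ + (c.M₀ + c.C₀))

/-- The growth of the expected step error, in units of `Δ³`, with the expected gradient norm. -/
def errorSlope (c : Constants) : ℝ := 2 * (c.G₁ + c.K₁ + (c.M₁ + c.C₁))

/-- Below this radius a step stays in the domain of second-order smoothness, and the part of the
step errors that is proportional to the gradient norms is absorbed by the decrease. -/
def radiusThreshold (c : Constants) : ℝ := min c.δ (1 / (2 * (1 + c.errorSlope)))

/-- Bound for the gradient norm at a point whose objective value exceeds the infimum by at most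
`D`. -/
def gradientBound (c : Constants) (D : ℝ) : ℝ := 2 * D * (c.L₀ + c.L₁) + 1

/-- Bound for the total error and decrease of a run of at most `b / Δ³` iterations. -/
def budget (c : Constants) (D b : ℝ) : ℝ := D + c.errorOffset * b + c.gradientBound D

/-- A multiple of `Δ` bounding every gradient norm along a run of at most `b / Δ³` iterations whose
radius is above the threshold. There are boundedly many such iterations, and each of them at most
doubles the gradient norm, up to an additive constant. -/
def growthBound (c : Constants) (D b : ℝ) : ℝ :=
  2 ^ ⌈b / c.radiusThreshold ^ 3⌉₊ * (c.gradientBound D / c.radiusThreshold + c.L₀)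

/-- The constant of the convergence rate. The first term is for radii below the threshold, the
other two are for radii above it. -/
def rate (c : Constants) (D a b : ℝ) : ℝ :=
  max (4 * c.budget D b / a) (max (c.growthBound D b / c.radiusThreshold)
    (c.L₀ / c.radiusThreshold + c.L₁ * c.growthBound D b))

variable (c : Constants) {D a b Δ : ℝ}

theorem errorOffset_nonneg : 0 ≤ c.errorOffset := by
  have := c.G₀_nonneg
  have := c.K₀_nonneg
  have := c.M₀_nonneg
  have := c.C₀_nonneg
  unfold errorOffset
  positivity

theorem errorSlope_nonneg : 0 ≤ c.errorSlope := by
  have := c.G₁_nonneg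
  have := c.K₁_nonneg
  have := c.M₁_nonneg
  have := c.C₁_nonneg
  unfold errorSlope
  positivity

theorem radiusThreshold_pos : 0 < c.radiusThreshold := by
  have := c.errorSlope_nonneg
  exact lt_min c.δ_pos (by positivity)

theorem gradientBound_pos (hD : 0 ≤ D) : 0 < c.gradientBound D := by
  have := c.L₀_pos
  have := c.L₁_nonneg
  unfold gradientBound
  positivity

theorem budget_pos (hD : 0 ≤ D) (hb : 0 ≤ b) : 0 < c.budget D b :=
  add_pos_of_nonneg_of_pos (add_nonneg hD (mul_nonneg c.errorOffset_nonneg hb))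
    (c.gradientBound_pos hD)

theorem growthBound_nonneg (hD : 0 ≤ D) : 0 ≤ c.growthBound D b := by
  have := c.gradientBound_pos hD
  have := c.radiusThreshold_pos
  have := c.L₀_pos
  unfold growthBound
  positivity

theorem rate_pos (hD : 0 ≤ D) (ha : 0 < a) (hb : 0 ≤ b) : 0 < c.rate D a b :=
  lt_max_of_lt_left (div_pos (mul_pos four_pos (c.budget_pos hD hb)) ha)

theorem radiusThreshold_le_half : c.radiusThreshold ≤ 1 / 2 := by
  refine (min_le_right _ _).trans ?_
  gcongr
  linarith [c.errorSlope_nonneg]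

theorem errorSlope_mul_sq_le (hΔ₀ : 0 ≤ Δ) (hΔ : Δ ≤ c.radiusThreshold) :
    c.errorSlope * Δ ^ 2 ≤ 1 / 4 := by
  have hslope := c.errorSlope_nonneg
  have hhalf : Δ ≤ 1 / 2 := hΔ.trans c.radiusThreshold_le_half
  have hprod : Δ * (2 * (1 + c.errorSlope)) ≤ 1 :=
    (le_div_iff₀ (by positivity)).1 (hΔ.trans (min_le_right _ _))
  have hslopeΔ : c.errorSlope * Δ ≤ 1 / 2 := by linarith
  calc c.errorSlope * Δ ^ 2 = (c.errorSlope * Δ) * Δ := by ring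
    _ ≤ 1 / 2 * (1 / 2) := by gcongr
    _ = 1 / 4 := by norm_num

end Constants

end Constants

section RegularRun

variable {n k : ℕ} {Ξ Ω : Type*} [MeasurableSpace Ξ]

/-- The assumptions on the stochastic problem: measurability, integrability (without which the
objective would be a junk value) and differentiability of the samples, smoothness of the
objective, and unbiasedness and bounded variance of the sampled derivatives. -/
structure IsRegularProblem (c : Constants) (P : Measure Ξ) (f : Vec n → Ξ → ℝ) : Prop where
  measurable : Measurable (Function.uncurry f)
  integrable : ∀ y, Integrable (f y) P
  twiceDifferentiable : ∀ ξ, TwiceDifferentiable fun x => f x ξ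
  smooth : GeneralizedSmooth (objective P f) c.L₀ c.L₁
  secondOrderSmooth : SecondOrderSmooth (objective P f) c.δ c.M₀ c.M₁
  gradient_variance : BoundedGradientVariance P f c.G₀ c.G₁
  hess_variance : BoundedHessianVariance P f c.K₀ c.K₁

/-- A run whose radius respects the local smoothness of the objective, whose batches are large
enough for the errors of the estimates to be of order `Δ²` and `Δ`, and whose subspaces satisfy the
inexactness condition. -/
structure IsRegularRun [mΩ : MeasurableSpace Ω] (c : Constants) (P : Measure Ξ)
    (f : Vec n → Ξ → ℝ) (μ : Measure Ω) (ℱ : Filtration ℕ mΩ) (x₀ : Vec n) (Δ : ℝ) (T m₁ m₂ : ℕ)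
    (S₁ : ℕ → Fin m₁ → Ω → Ξ) (S₂ : ℕ → Fin m₂ → Ω → Ξ) (V : ℕ → Ω → Matrix (Fin n) (Fin k) ℝ)
    (x d : ℕ → Ω → Vec n) : Prop extends IsRun P f μ ℱ x₀ Δ T m₁ m₂ S₁ S₂ V x d where
  radius_pos : 0 < Δ
  radius_le : c.L₁ * Δ ≤ 1
  batch₁_size : (Δ ^ 4)⁻¹ ≤ m₁
  batch₂_size : 22 * Real.log n * (Δ ^ 2)⁻¹ ≤ m₂
  inexact : SubspaceInexactness (objective P f) μ T V x d c.C₀ c.C₁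

/-- The step error of iteration `t` of a run. -/
def runError (c : Constants) (P : Measure Ξ) (f : Vec n → Ξ → ℝ) (Δ : ℝ) {m₁ m₂ : ℕ}
    (S₁ : ℕ → Fin m₁ → Ω → Ξ) (S₂ : ℕ → Fin m₂ → Ω → Ξ) (x : ℕ → Ω → Vec n) (t : ℕ) (ω : Ω) : ℝ :=
  stepError Δ
    ‖gradient (batch f fun i => S₁ t i ω) (x t ω) - gradient (objective P f) (x t ω)‖
    ‖hess (batch f fun i => S₂ t i ω) (x t ω) - hess (objective P f) (x t ω)‖
    (c.M₀ + c.M₁ * ‖gradient (objective P f) (x t ω)‖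
      + (c.C₀ + c.C₁ * ‖gradient (objective P f) (x t ω)‖))

variable [mΩ : MeasurableSpace Ω] {c : Constants} {P : Measure Ξ} {f : Vec n → Ξ → ℝ}
  {μ : Measure Ω} {ℱ : Filtration ℕ mΩ} {x₀ : Vec n} {Δ D a b : ℝ} {T m₁ m₂ : ℕ}
  {S₁ : ℕ → Fin m₁ → Ω → Ξ} {S₂ : ℕ → Fin m₂ → Ω → Ξ}
  {V : ℕ → Ω → Matrix (Fin n) (Fin k) ℝ} {x d : ℕ → Ω → Vec n} {t : ℕ}

theorem IsRegularProblem.continuous_hess (hp : IsRegularProblem c P f) :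
    Continuous (hess (objective P f)) :=
  hp.secondOrderSmooth.continuous_hess c.δ_pos

theorem IsRegularProblem.continuous_gradient (hp : IsRegularProblem c P f) :
    Continuous (gradient (objective P f)) :=
  hp.secondOrderSmooth.1.2.continuous

theorem IsRegularProblem.norm_gradient_le (hp : IsRegularProblem c P f)
    (hD : ∀ y, objective P f x₀ - objective P f y ≤ D) :
    ‖gradient (objective P f) x₀‖ ≤ c.gradientBound D :=
  hp.smooth.norm_gradient_le c.L₀_pos c.L₁_nonneg hD

namespace IsRegularRun

theorem ae_decrease [NeZero n] (hp : IsRegularProblem c P f)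
    (h : IsRegularRun c P f μ ℱ x₀ Δ T m₁ m₂ S₁ S₂ V x d) (hΔ : Δ ≤ c.δ) (ht : t < T) :
    ∀ᵐ ω ∂μ, Δ / 2 * ‖gradient (objective P f) (x (t + 1) ω)‖
        ≤ objective P f (x t ω) - objective P f (x (t + 1) ω) + runError c P f Δ S₁ S₂ x t ω ∧
      Δ ^ 2 / 2 * -lambdaMin (projected (V t ω) (hess (objective P f) (x (t + 1) ω)))
        ≤ objective P f (x t ω) - objective P f (x (t + 1) ω)
          + runError c P f Δ S₁ S₂ x t ω := by
  have := c.M₀_nonneg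
  have := c.M₁_nonneg
  have := c.C₀_nonneg
  have := c.C₁_nonneg
  filter_upwards [h.inexact t ht] with ω hω
  rw [h.update t ht ω]
  exact (h.step t ht ω).norm_gradient_and_neg_lambdaMin_le hp.secondOrderSmooth.1 h.radius_pos
    (by positivity) (by positivity)
    (fun y hy => hp.secondOrderSmooth.2 (x t ω) y (hy.trans hΔ))
    (isSelfAdjoint_hess_batch hp.twiceDifferentiable _ _) (h.basis_orthonormal t ht ω) hω

section Integrability

variable [IsProbabilityMeasure μ]

theorem integrable_norm_gradient (hp : IsRegularProblem c P f)
    (h : IsRegularRun c P f μ ℱ x₀ Δ T m₁ m₂ S₁ S₂ V x d) (ht : t ≤ T) :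
    Integrable (fun ω => ‖gradient (objective P f) (x t ω)‖) μ :=
  h.toIsRun.integrable_norm_gradient c.L₀_pos.le c.L₁_nonneg h.radius_pos.le h.radius_le hp.smooth
    hp.continuous_gradient ht

theorem integrable_lambdaMin [NeZero n] (hp : IsRegularProblem c P f)
    (h : IsRegularRun c P f μ ℱ x₀ Δ T m₁ m₂ S₁ S₂ V x d) (ht : t < T) :
    Integrable
      (fun ω => lambdaMin (projected (V t ω) (hess (objective P f) (x (t + 1) ω)))) μ := by
  have hbound : Integrable
      (fun ω => c.L₀ + c.L₁ * ‖gradient (objective P f) (x (t + 1) ω)‖) μ :=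
    (integrable_const _).add ((h.integrable_norm_gradient hp ht).const_mul _)
  exact hbound.mono'
    (h.measurable_lambdaMin hp.secondOrderSmooth.1 hp.continuous_hess ht).aestronglyMeasurable
    (.of_forall fun ω =>
      h.abs_lambdaMin_le c.L₀_pos.le c.L₁_nonneg hp.smooth hp.secondOrderSmooth.1 ht ω)

variable [IsProbabilityMeasure P]

theorem integrable_and_integral_gradient_error_le (hp : IsRegularProblem c P f)
    (h : IsRegularRun c P f μ ℱ x₀ Δ T m₁ m₂ S₁ S₂ V x d) (ht : t < T) :
    Integrable (fun ω => ‖gradient (batch f fun i => S₁ t i ω) (x t ω)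
        - gradient (objective P f) (x t ω)‖) μ ∧
      ∫ ω, ‖gradient (batch f fun i => S₁ t i ω) (x t ω) - gradient (objective P f) (x t ω)‖ ∂μ
        ≤ Δ ^ 2 * (c.G₀ + c.G₁ * ∫ ω, ‖gradient (objective P f) (x t ω)‖ ∂μ) := by
  have := c.G₀_nonneg
  have := c.G₁_nonneg
  have hgrad := hp.continuous_gradient.measurable
  have hdiff := fun ξ => (hp.twiceDifferentiable ξ).1
  have hint := h.integrable_norm_gradient hp ht.le
  have hmeas : Measurable fun p : Vec n × (Fin m₁ → Ξ) =>
      gradient (batch f p.2) p.1 - gradient (objective P f) p.1 :=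
    (measurable_gradient_batch hp.measurable hdiff).sub (hgrad.comp measurable_fst)
  obtain ⟨herr, hle⟩ := integrable_norm_and_integral_norm_le_of_map_prodMk
    (h.measurable_iterate ht.le) (measurable_pi_lambda _ (h.measurable_sample₁ ht))
    (h.map_iterate_batch₁ ht) hmeas (((hgrad.norm.const_mul c.G₁).const_add _).const_mul (Δ ^ 2))
    (fun y => by positivity)
    (lintegral_gradient_batch_sub_le c.G₀_nonneg c.G₁_nonneg hp.measurable hdiff
      hp.gradient_variance h.radius_pos h.batch₁_size)
    (((integrable_const _).add (hint.const_mul c.G₁)).const_mul _)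
  refine ⟨herr, hle.trans_eq ?_⟩
  rw [integral_const_mul, integral_const_add_const_mul hint]

theorem integrable_and_integral_hess_error_le (hn : 2 ≤ n) (hp : IsRegularProblem c P f)
    (h : IsRegularRun c P f μ ℱ x₀ Δ T m₁ m₂ S₁ S₂ V x d) (ht : t < T) :
    Integrable (fun ω => ‖hess (batch f fun j => S₂ t j ω) (x t ω)
        - hess (objective P f) (x t ω)‖) μ ∧
      ∫ ω, ‖hess (batch f fun j => S₂ t j ω) (x t ω) - hess (objective P f) (x t ω)‖ ∂μ
        ≤ Δ * (1 + c.K₀ + c.K₁ * ∫ ω, ‖gradient (objective P f) (x t ω)‖ ∂μ) := by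
  have := c.K₀_nonneg
  have := c.K₁_nonneg
  have hΔ := h.radius_pos
  have hgrad := hp.continuous_gradient.measurable
  have hint := h.integrable_norm_gradient hp ht.le
  have hmeas : Measurable fun p : Vec n × (Fin m₂ → Ξ) =>
      hess (batch f p.2) p.1 - hess (objective P f) p.1 :=
    (measurable_hess_batch hp.measurable hp.twiceDifferentiable).sub
      (hp.continuous_hess.measurable.comp measurable_fst)
  obtain ⟨herr, hle⟩ := integrable_norm_and_integral_norm_le_of_map_prodMk
    (h.measurable_iterate ht.le) (measurable_pi_lambda _ (h.measurable_sample₂ ht))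
    (h.map_iterate_batch₂ ht) hmeas (((hgrad.norm.const_mul c.K₁).const_add _).const_mul Δ)
    (fun y => by positivity)
    (lintegral_hess_batch_sub_le hn c.K₀_nonneg c.K₁_nonneg hp.measurable hp.twiceDifferentiable
      hp.secondOrderSmooth.1 hp.hess_variance h.radius_pos h.batch₂_size)
    (((integrable_const _).add (hint.const_mul c.K₁)).const_mul _)
  refine ⟨herr, hle.trans_eq ?_⟩
  rw [integral_const_mul, integral_const_add_const_mul hint]

theorem integrable_and_integral_runError_le (hn : 2 ≤ n) (hp : IsRegularProblem c P f)
    (h : IsRegularRun c P f μ ℱ x₀ Δ T m₁ m₂ S₁ S₂ V x d) (ht : t < T) :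
    Integrable (runError c P f Δ S₁ S₂ x t) μ ∧
      ∫ ω, runError c P f Δ S₁ S₂ x t ω ∂μ ≤ Δ ^ 3 * (c.errorOffset
        + c.errorSlope * ∫ ω, ‖gradient (objective P f) (x t ω)‖ ∂μ) := by
  obtain ⟨hg, hg_le⟩ := h.integrable_and_integral_gradient_error_le hp ht
  obtain ⟨hH, hH_le⟩ := h.integrable_and_integral_hess_error_le hn hp ht
  have hint := h.integrable_norm_gradient hp ht.le
  have hM : Integrable (fun ω => c.M₀ + c.M₁ * ‖gradient (objective P f) (x t ω)‖) μ :=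
    (integrable_const _).add (hint.const_mul _)
  have hC : Integrable (fun ω => c.C₀ + c.C₁ * ‖gradient (objective P f) (x t ω)‖) μ :=
    (integrable_const _).add (hint.const_mul _)
  refine ⟨integrable_stepError hg hH (hM.add hC) Δ, ?_⟩
  refine (integral_stepError hg hH (hM.add hC) Δ).trans_le
    ((stepError_le_stepError h.radius_pos.le hg_le hH_le).trans_eq ?_)
  rw [integral_add' hM hC, integral_const_add_const_mul hint, integral_const_add_const_mul hint,
    stepError, Constants.errorOffset, Constants.errorSlope]
  ring

end Integrability

end IsRegularRun

end RegularRun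

section Rate

theorem inv_mul_le_of_pow_mul_le {a B s Δ T : ℝ} {i j : ℕ} (ha : 0 < a) (hB : 0 ≤ B)
    (hΔ : 0 < Δ) (hT : a ≤ T * Δ ^ (i + j)) (hs : Δ ^ i * s ≤ B) :
    T⁻¹ * s ≤ B / a * Δ ^ j := by
  have hT₀ : 0 < T := pos_of_mul_pos_left (ha.trans_le hT) (by positivity)
  rw [inv_mul_le_iff₀ hT₀]
  refine le_of_mul_le_mul_left ?_ (pow_pos hΔ i)
  calc Δ ^ i * s ≤ B := hs
    _ = B / a * a := by field_simp
    _ ≤ B / a * (T * Δ ^ (i + j)) := by gcongr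
    _ = Δ ^ i * (T * (B / a * Δ ^ j)) := by ring

variable {n k : ℕ} {Ξ Ω : Type*} [MeasurableSpace Ξ] [mΩ : MeasurableSpace Ω] {c : Constants}
  {P : Measure Ξ} {f : Vec n → Ξ → ℝ} {μ : Measure Ω} {ℱ : Filtration ℕ mΩ} {x₀ : Vec n}
  {Δ D a b : ℝ} {T m₁ m₂ : ℕ} {S₁ : ℕ → Fin m₁ → Ω → Ξ} {S₂ : ℕ → Fin m₂ → Ω → Ξ}
  {V : ℕ → Ω → Matrix (Fin n) (Fin k) ℝ} {x d : ℕ → Ω → Vec n} {t : ℕ}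

namespace IsRegularRun

section LargeRadius

theorem norm_gradient_le_growthBound_mul (hp : IsRegularProblem c P f)
    (h : IsRegularRun c P f μ ℱ x₀ Δ T m₁ m₂ S₁ S₂ V x d)
    (hD : ∀ y, objective P f x₀ - objective P f y ≤ D) (hΔ : c.radiusThreshold ≤ Δ)
    (hT : T * Δ ^ 3 ≤ b) (ht : t ≤ T) (ω : Ω) :
    ‖gradient (objective P f) (x t ω)‖ ≤ c.growthBound D b * Δ := by
  have hr := c.radiusThreshold_pos
  have hL₀ := c.L₀_pos
  have hΔ₀ := h.radius_pos
  have hbound : 0 ≤ c.gradientBound D := (norm_nonneg _).trans (hp.norm_gradient_le hD)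
  have htN : t ≤ ⌈b / c.radiusThreshold ^ 3⌉₊ := by
    have hTb : (T : ℝ) ≤ b / c.radiusThreshold ^ 3 := by
      rw [le_div_iff₀ (by positivity)]
      exact le_trans (by gcongr) hT
    exact ht.trans (by exact_mod_cast hTb.trans (Nat.le_ceil _))
  have hscale : c.gradientBound D ≤ c.gradientBound D / c.radiusThreshold * Δ := by
    rw [div_mul_eq_mul_div, le_div_iff₀ hr]
    gcongr
  calc ‖gradient (objective P f) (x t ω)‖
      ≤ ‖gradient (objective P f) (x t ω)‖ + c.L₀ * Δ := le_add_of_nonneg_right (by positivity)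
    _ ≤ 2 ^ t * (‖gradient (objective P f) x₀‖ + c.L₀ * Δ) :=
        h.norm_gradient_add_le hL₀.le c.L₁_nonneg h.radius_le hp.smooth ht ω
    _ ≤ 2 ^ ⌈b / c.radiusThreshold ^ 3⌉₊
          * (c.gradientBound D / c.radiusThreshold * Δ + c.L₀ * Δ) := by
        gcongr
        · exact one_le_two
        · exact (hp.norm_gradient_le hD).trans hscale
    _ = c.growthBound D b * Δ := by
        rw [Constants.growthBound]
        ring

theorem norm_gradient_le_of_threshold_le (hp : IsRegularProblem c P f)
    (h : IsRegularRun c P f μ ℱ x₀ Δ T m₁ m₂ S₁ S₂ V x d)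
    (hD : ∀ y, objective P f x₀ - objective P f y ≤ D) (hΔ : c.radiusThreshold ≤ Δ)
    (hT : T * Δ ^ 3 ≤ b) (ht : t ≤ T) (ω : Ω) :
    ‖gradient (objective P f) (x t ω)‖ ≤ c.growthBound D b / c.radiusThreshold * Δ ^ 2 := by
  have hr := c.radiusThreshold_pos
  have hΔ₀ := h.radius_pos
  have hgrowth := c.growthBound_nonneg (b := b) ((sub_self _).ge.trans (hD x₀))
  calc ‖gradient (objective P f) (x t ω)‖ ≤ c.growthBound D b * Δ :=
        h.norm_gradient_le_growthBound_mul hp hD hΔ hT ht ω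
    _ = c.growthBound D b / c.radiusThreshold * (c.radiusThreshold * Δ) := by field_simp
    _ ≤ c.growthBound D b / c.radiusThreshold * (Δ * Δ) := by gcongr
    _ = c.growthBound D b / c.radiusThreshold * Δ ^ 2 := by rw [sq]

theorem neg_lambdaMin_le_of_threshold_le [NeZero n] (hp : IsRegularProblem c P f)
    (h : IsRegularRun c P f μ ℱ x₀ Δ T m₁ m₂ S₁ S₂ V x d)
    (hD : ∀ y, objective P f x₀ - objective P f y ≤ D) (hΔ : c.radiusThreshold ≤ Δ)
    (hT : T * Δ ^ 3 ≤ b) (ht : t < T) (ω : Ω) :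
    -lambdaMin (projected (V t ω) (hess (objective P f) (x (t + 1) ω)))
      ≤ (c.L₀ / c.radiusThreshold + c.L₁ * c.growthBound D b) * Δ := by
  have hr := c.radiusThreshold_pos
  have hL₀ := c.L₀_pos
  have hL₁ := c.L₁_nonneg
  calc -lambdaMin (projected (V t ω) (hess (objective P f) (x (t + 1) ω)))
      ≤ c.L₀ + c.L₁ * ‖gradient (objective P f) (x (t + 1) ω)‖ :=
        (neg_le_abs _).trans
          (h.abs_lambdaMin_le hL₀.le hL₁ hp.smooth hp.secondOrderSmooth.1 ht ω)
    _ ≤ c.L₀ + c.L₁ * (c.growthBound D b * Δ) := by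
        gcongr
        exact h.norm_gradient_le_growthBound_mul hp hD hΔ hT ht ω
    _ = c.L₀ / c.radiusThreshold * c.radiusThreshold + c.L₁ * c.growthBound D b * Δ := by
        field_simp
    _ ≤ c.L₀ / c.radiusThreshold * Δ + c.L₁ * c.growthBound D b * Δ := by gcongr
    _ = (c.L₀ / c.radiusThreshold + c.L₁ * c.growthBound D b) * Δ := by ring

end LargeRadius

variable [IsProbabilityMeasure μ]

theorem sum_integral_norm_gradient_le_add (hp : IsRegularProblem c P f)
    (h : IsRegularRun c P f μ ℱ x₀ Δ T m₁ m₂ S₁ S₂ V x d)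
    (hD : ∀ y, objective P f x₀ - objective P f y ≤ D) :
    ∑ t ∈ Finset.range T, ∫ ω, ‖gradient (objective P f) (x t ω)‖ ∂μ ≤ c.gradientBound D
      + ∑ t ∈ Finset.range T, ∫ ω, ‖gradient (objective P f) (x (t + 1) ω)‖ ∂μ := by
  have hstart : ∫ ω, ‖gradient (objective P f) (x 0 ω)‖ ∂μ ≤ c.gradientBound D := by
    simpa [h.start] using hp.norm_gradient_le hD
  have hlast : 0 ≤ ∫ ω, ‖gradient (objective P f) (x T ω)‖ ∂μ :=
    integral_nonneg fun _ => norm_nonneg _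
  have hshift := (Finset.sum_range_succ
    (fun t => ∫ ω, ‖gradient (objective P f) (x t ω)‖ ∂μ) T).symm.trans
    (Finset.sum_range_succ' _ T)
  linarith

section SmallRadius

variable [IsProbabilityMeasure P]

theorem sum_integral_runError_le (hn : 2 ≤ n) (hp : IsRegularProblem c P f)
    (h : IsRegularRun c P f μ ℱ x₀ Δ T m₁ m₂ S₁ S₂ V x d)
    (hD : ∀ y, objective P f x₀ - objective P f y ≤ D) (hΔ : Δ ≤ c.radiusThreshold)
    (hT : T * Δ ^ 3 ≤ b) :
    ∑ t ∈ Finset.range T, ∫ ω, runError c P f Δ S₁ S₂ x t ω ∂μ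
      ≤ c.errorOffset * b + c.gradientBound D
        + Δ / 4 * ∑ t ∈ Finset.range T, ∫ ω, ‖gradient (objective P f) (x (t + 1) ω)‖ ∂μ := by
  set σ := ∑ t ∈ Finset.range T, ∫ ω, ‖gradient (objective P f) (x (t + 1) ω)‖ ∂μ
  set σ₀ := ∑ t ∈ Finset.range T, ∫ ω, ‖gradient (objective P f) (x t ω)‖ ∂μ
  have hΔ₀ := h.radius_pos
  have hoffset := c.errorOffset_nonneg
  have hσ₀ : σ₀ ≤ c.gradientBound D + σ := h.sum_integral_norm_gradient_le_add hp hD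
  have : 0 ≤ σ₀ :=
    Finset.sum_nonneg fun t _ => integral_nonneg fun _ => norm_nonneg _
  have hbound : 0 ≤ c.gradientBound D := (norm_nonneg _).trans (hp.norm_gradient_le hD)
  have hΔ_le : Δ / 4 ≤ 1 := by linarith [hΔ.trans c.radiusThreshold_le_half]
  calc ∑ t ∈ Finset.range T, ∫ ω, runError c P f Δ S₁ S₂ x t ω ∂μ
      ≤ ∑ t ∈ Finset.range T, Δ ^ 3 * (c.errorOffset
          + c.errorSlope * ∫ ω, ‖gradient (objective P f) (x t ω)‖ ∂μ) :=
        Finset.sum_le_sum fun t ht =>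
          (h.integrable_and_integral_runError_le hn hp (Finset.mem_range.1 ht)).2
    _ = c.errorOffset * (T * Δ ^ 3) + c.errorSlope * Δ ^ 2 * Δ * σ₀ := by
        rw [← Finset.mul_sum, Finset.sum_add_distrib, ← Finset.mul_sum, Finset.sum_const,
          Finset.card_range, nsmul_eq_mul]
        ring
    _ ≤ c.errorOffset * b + 1 / 4 * Δ * (c.gradientBound D + σ) := by
        gcongr
        exact c.errorSlope_mul_sq_le hΔ₀.le hΔ
    _ = c.errorOffset * b + Δ / 4 * c.gradientBound D + Δ / 4 * σ := by ring
    _ ≤ c.errorOffset * b + 1 * c.gradientBound D + Δ / 4 * σ := by gcongr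
    _ = c.errorOffset * b + c.gradientBound D + Δ / 4 * σ := by rw [one_mul]

theorem sum_integral_le_budget_add (hn : 2 ≤ n) (hp : IsRegularProblem c P f)
    (h : IsRegularRun c P f μ ℱ x₀ Δ T m₁ m₂ S₁ S₂ V x d)
    (hD : ∀ y, objective P f x₀ - objective P f y ≤ D) (hΔ : Δ ≤ c.radiusThreshold)
    (hT : T * Δ ^ 3 ≤ b) {U : ℕ → Ω → ℝ} (hU : ∀ t < T, Integrable (U t) μ)
    (hdec : ∀ t < T, ∀ᵐ ω ∂μ, U t ω ≤ objective P f (x t ω) - objective P f (x (t + 1) ω)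
      + runError c P f Δ S₁ S₂ x t ω) :
    ∑ t ∈ Finset.range T, ∫ ω, U t ω ∂μ ≤ c.budget D b
      + Δ / 4 * ∑ t ∈ Finset.range T, ∫ ω, ‖gradient (objective P f) (x (t + 1) ω)‖ ∂μ := by
  have hstart : ∀ ω, objective P f (x 0 ω) - objective P f (x T ω) ≤ D := fun ω => by
    rw [h.start ω]
    exact hD _
  have hsum := sum_integral_le_of_ae_le_sub_add (F := fun t ω => objective P f (x t ω)) hstart hU
    (fun t ht => (h.integrable_and_integral_runError_le hn hp ht).1) hdec
  have herror := h.sum_integral_runError_le hn hp hD hΔ hT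
  unfold Constants.budget
  linarith

theorem mul_sum_integral_norm_gradient_le (hn : 2 ≤ n) (hp : IsRegularProblem c P f)
    (h : IsRegularRun c P f μ ℱ x₀ Δ T m₁ m₂ S₁ S₂ V x d)
    (hD : ∀ y, objective P f x₀ - objective P f y ≤ D) (hΔ : Δ ≤ c.radiusThreshold)
    (hT : T * Δ ^ 3 ≤ b) :
    Δ * ∑ t ∈ Finset.range T, ∫ ω, ‖gradient (objective P f) (x (t + 1) ω)‖ ∂μ
      ≤ 4 * c.budget D b := by
  have : NeZero n := ⟨by omega⟩
  have hsum := h.sum_integral_le_budget_add hn hp hD hΔ hT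
    (fun t ht => (h.integrable_norm_gradient hp ht).const_mul (Δ / 2))
    fun t ht => (h.ae_decrease hp (hΔ.trans (min_le_left _ _)) ht).mono fun _ => And.left
  simp only [integral_const_mul, ← Finset.mul_sum] at hsum
  linarith

theorem sq_mul_sum_integral_neg_lambdaMin_le (hn : 2 ≤ n) (hp : IsRegularProblem c P f)
    (h : IsRegularRun c P f μ ℱ x₀ Δ T m₁ m₂ S₁ S₂ V x d)
    (hD : ∀ y, objective P f x₀ - objective P f y ≤ D) (hΔ : Δ ≤ c.radiusThreshold)
    (hT : T * Δ ^ 3 ≤ b) :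
    Δ ^ 2 * ∑ t ∈ Finset.range T,
        ∫ ω, -lambdaMin (projected (V t ω) (hess (objective P f) (x (t + 1) ω))) ∂μ
      ≤ 4 * c.budget D b := by
  have : NeZero n := ⟨by omega⟩
  have hsum := h.sum_integral_le_budget_add hn hp hD hΔ hT
    (fun t ht => (h.integrable_lambdaMin hp ht).neg.const_mul (Δ ^ 2 / 2))
    fun t ht => (h.ae_decrease hp (hΔ.trans (min_le_left _ _)) ht).mono fun _ => And.right
  have hgrad := h.mul_sum_integral_norm_gradient_le hn hp hD hΔ hT
  simp only [Pi.neg_apply, integral_const_mul, ← Finset.mul_sum] at hsum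
  linarith

end SmallRadius

variable [IsProbabilityMeasure P]

theorem integral_norm_gradient_le_rate (hn : 2 ≤ n) (hp : IsRegularProblem c P f)
    (h : IsRegularRun c P f μ ℱ x₀ Δ T m₁ m₂ S₁ S₂ V x d) (ha : 0 < a)
    (hD : ∀ y, objective P f x₀ - objective P f y ≤ D) (haT : a ≤ T * Δ ^ 3)
    (hTb : T * Δ ^ 3 ≤ b) :
    ∫ p : ℕ × Ω, ‖gradient (objective P f) (x (p.1 + 1) p.2)‖ ∂(withUniformIndex T μ)
      ≤ c.rate D a b * Δ ^ 2 := by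
  have hΔ₀ := h.radius_pos
  have hint : ∀ t < T, Integrable (fun ω => ‖gradient (objective P f) (x (t + 1) ω)‖) μ :=
    fun t ht => h.integrable_norm_gradient hp ht
  rcases le_total Δ c.radiusThreshold with hΔ | hΔ
  · have hbudget := c.budget_pos ((sub_self _).ge.trans (hD x₀)) (ha.le.trans (haT.trans hTb))
    rw [integral_withUniformIndex hint]
    refine (inv_mul_le_of_pow_mul_le (i := 1) ha (by positivity) hΔ₀ haT ?_).trans
      (mul_le_mul_of_nonneg_right (le_max_left _ _) (by positivity))
    rw [pow_one]
    exact h.mul_sum_integral_norm_gradient_le hn hp hD hΔ hTb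
  · have hT : 0 < T := by exact_mod_cast pos_of_mul_pos_left (ha.trans_le haT) (by positivity)
    exact (integral_withUniformIndex_le_of_le hT hint fun t ht =>
      h.norm_gradient_le_of_threshold_le hp hD hΔ hTb ht).trans
      (mul_le_mul_of_nonneg_right ((le_max_left _ _).trans (le_max_right _ _)) (by positivity))

theorem neg_rate_le_integral_lambdaMin (hn : 2 ≤ n) (hp : IsRegularProblem c P f)
    (h : IsRegularRun c P f μ ℱ x₀ Δ T m₁ m₂ S₁ S₂ V x d) (ha : 0 < a)
    (hD : ∀ y, objective P f x₀ - objective P f y ≤ D) (haT : a ≤ T * Δ ^ 3)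
    (hTb : T * Δ ^ 3 ≤ b) :
    -(c.rate D a b * Δ) ≤ ∫ p : ℕ × Ω, lambdaMin (projected (V p.1 p.2)
      (hess (objective P f) (x (p.1 + 1) p.2))) ∂(withUniformIndex T μ) := by
  have : NeZero n := ⟨by omega⟩
  have hΔ₀ := h.radius_pos
  have hint : ∀ t < T, Integrable
      (fun ω => -lambdaMin (projected (V t ω) (hess (objective P f) (x (t + 1) ω)))) μ :=
    fun t ht => (h.integrable_lambdaMin hp ht).neg
  rw [neg_le, ← integral_neg]
  rcases le_total Δ c.radiusThreshold with hΔ | hΔ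
  · have hbudget := c.budget_pos ((sub_self _).ge.trans (hD x₀)) (ha.le.trans (haT.trans hTb))
    rw [integral_withUniformIndex hint]
    refine (inv_mul_le_of_pow_mul_le (i := 2) (j := 1) ha (by positivity) hΔ₀ haT
      (h.sq_mul_sum_integral_neg_lambdaMin_le hn hp hD hΔ hTb)).trans ?_
    rw [pow_one]
    exact mul_le_mul_of_nonneg_right (le_max_left _ _) hΔ₀.le
  · have hT : 0 < T := by exact_mod_cast pos_of_mul_pos_left (ha.trans_le haT) (by positivity)
    exact (integral_withUniformIndex_le_of_le hT hint fun t ht =>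
      h.neg_lambdaMin_le_of_threshold_le hp hD hΔ hTb ht).trans
      (mul_le_mul_of_nonneg_right ((le_max_right _ _).trans (le_max_right _ _)) hΔ₀.le)

end IsRegularRun

end Rate

section SquareRootScaling

variable {ε : ℝ}

theorem rpow_neg_div_two_eq_inv_sqrt_pow (hε : 0 ≤ ε) (j : ℕ) :
    ε ^ (-(j / 2) : ℝ) = (√ε ^ j)⁻¹ := by
  rw [Real.rpow_neg hε, Real.sqrt_eq_rpow, ← Real.rpow_natCast, ← Real.rpow_mul hε,
    one_div_mul_eq_div]

theorem rpow_neg_three_halves_eq (hε : 0 ≤ ε) : ε ^ (-(3 / 2) : ℝ) = (√ε ^ 3)⁻¹ := by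
  exact_mod_cast rpow_neg_div_two_eq_inv_sqrt_pow hε 3

theorem IsRun.isRegularRun_sqrt {n k : ℕ} {Ξ Ω : Type*} [MeasurableSpace Ξ]
    [mΩ : MeasurableSpace Ω] {c : Constants} {P : Measure Ξ} {f : Vec n → Ξ → ℝ} {μ : Measure Ω}
    {ℱ : Filtration ℕ mΩ} {x₀ : Vec n} {T m₁ m₂ : ℕ} {S₁ : ℕ → Fin m₁ → Ω → Ξ}
    {S₂ : ℕ → Fin m₂ → Ω → Ξ} {V : ℕ → Ω → Matrix (Fin n) (Fin k) ℝ} {x d : ℕ → Ω → Vec n}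
    (h : IsRun P f μ ℱ x₀ √ε T m₁ m₂ S₁ S₂ V x d)
    (hV : SubspaceInexactness (objective P f) μ T V x d c.C₀ c.C₁) (hε : 0 < ε)
    (hL₁ : c.L₁ ^ 2 * ε ≤ 1) (hm₁ : ε ^ (-2 : ℝ) ≤ m₁) (hm₂ : 22 * Real.log n * ε⁻¹ ≤ m₂) :
    IsRegularRun c P f μ ℱ x₀ √ε T m₁ m₂ S₁ S₂ V x d where
  toIsRun := h
  radius_pos := Real.sqrt_pos.2 hε
  radius_le := by
    rw [← Real.sq_sqrt hε.le, ← mul_pow] at hL₁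
    exact (sq_le_one_iff₀ (mul_nonneg c.L₁_nonneg (Real.sqrt_nonneg _))).1 hL₁
  batch₁_size := by
    have hpow : (√ε ^ 4)⁻¹ = ε ^ (-2 : ℝ) := by
      rw [← rpow_neg_div_two_eq_inv_sqrt_pow hε.le]
      norm_num
    rwa [hpow]
  batch₂_size := by rwa [Real.sq_sqrt hε.le]
  inexact := hV

end SquareRootScaling

theorem sub_le_of_sub_iInf_le {ι : Type*} {F : ι → ℝ} {x₀ : ι} {D : ℝ}
    (hF : BddBelow (Set.range F)) (hD : F x₀ - ⨅ x, F x ≤ D) (y : ι) : F x₀ - F y ≤ D := by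
  linarith [ciInf_le hF y]

end TrustRegion

end

theorem mainTheorem7_general (c : TrustRegion.Constants) (D b : ℝ) {a : ℝ} (ha : 0 < a) :
    ∃ C : ℝ, 0 < C ∧
      ∀ (n k : ℕ) (_ : 2 ≤ n)
        (Ξ : Type*) [MeasurableSpace Ξ] (P : Measure Ξ) [IsProbabilityMeasure P]
        (f : TrustRegion.Vec n → Ξ → ℝ) (_ : TrustRegion.IsRegularProblem c P f)
        (x₀ : TrustRegion.Vec n)
        (_ : BddBelow (Set.range (TrustRegion.objective P f)))
        (_ : TrustRegion.objective P f x₀ - ⨅ x, TrustRegion.objective P f x ≤ D)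
        (ε : ℝ) (_ : 0 < ε) (_ : c.L₁ ^ 2 * ε ≤ 1)
        (T : ℕ) (_ : a * ε ^ (-(3 / 2) : ℝ) ≤ T) (_ : (T : ℝ) ≤ b * ε ^ (-(3 / 2) : ℝ))
        (m₁ m₂ : ℕ) (_ : ε ^ (-2 : ℝ) ≤ m₁) (_ : 22 * Real.log n * ε⁻¹ ≤ m₂)
        (Ω : Type*) [mΩ : MeasurableSpace Ω] (μ : Measure Ω) [IsProbabilityMeasure μ]
        (ℱ : Filtration ℕ mΩ)
        (S₁ : ℕ → Fin m₁ → Ω → Ξ) (S₂ : ℕ → Fin m₂ → Ω → Ξ)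
        (V : ℕ → Ω → Matrix (Fin n) (Fin k) ℝ) (x d : ℕ → Ω → TrustRegion.Vec n)
        (_ : TrustRegion.IsRun P f μ ℱ x₀ (Real.sqrt ε) T m₁ m₂ S₁ S₂ V x d)
        (_ : TrustRegion.SubspaceInexactness (TrustRegion.objective P f) μ T V x d c.C₀ c.C₁),
        (Integrable (fun p : ℕ × Ω => ‖gradient (TrustRegion.objective P f) (x (p.1 + 1) p.2)‖)
            (TrustRegion.withUniformIndex T μ) ∧
          ∫ p : ℕ × Ω, ‖gradient (TrustRegion.objective P f) (x (p.1 + 1) p.2)‖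
            ∂(TrustRegion.withUniformIndex T μ) ≤ C * ε) ∧
        (Integrable (fun p : ℕ × Ω => TrustRegion.lambdaMin (TrustRegion.projected (V p.1 p.2)
              (TrustRegion.hess (TrustRegion.objective P f) (x (p.1 + 1) p.2))))
            (TrustRegion.withUniformIndex T μ) ∧
          -(C * Real.sqrt ε) ≤ ∫ p : ℕ × Ω, TrustRegion.lambdaMin (TrustRegion.projected (V p.1 p.2)
              (TrustRegion.hess (TrustRegion.objective P f) (x (p.1 + 1) p.2)))
            ∂(TrustRegion.withUniformIndex T μ)) := by
  refine ⟨c.rate (max D 0) a |b|, c.rate_pos (le_max_right _ _) ha (abs_nonneg b), ?_⟩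
  intro n k hn Ξ _ P _ f hp x₀ hbdd hD ε hε hL₁ T haT hTb m₁ m₂ hm₁ hm₂ Ω _ μ _ ℱ S₁ S₂ V x d h hV
  have : NeZero n := ⟨by omega⟩
  have hrun := h.isRegularRun_sqrt hV hε hL₁ hm₁ hm₂
  have hgap := TrustRegion.sub_le_of_sub_iInf_le hbdd (hD.trans (le_max_left D 0))
  have hΔ : 0 < √ε ^ 3 := pow_pos hrun.radius_pos 3
  rw [TrustRegion.rpow_neg_three_halves_eq hε.le, ← div_eq_mul_inv] at haT hTb
  replace haT : a ≤ T * √ε ^ 3 := (div_le_iff₀ hΔ).1 haT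
  replace hTb : T * √ε ^ 3 ≤ |b| := ((le_div_iff₀ hΔ).1 hTb).trans (le_abs_self b)
  have hT : 0 < T := by exact_mod_cast pos_of_mul_pos_left (ha.trans_le haT) hΔ.le
  have hrate := hrun.integral_norm_gradient_le_rate hn hp ha hgap haT hTb
  rw [Real.sq_sqrt hε.le] at hrate
  exact ⟨⟨TrustRegion.integrable_withUniformIndex hT fun t ht =>
        hrun.integrable_norm_gradient hp ht, hrate⟩,
    TrustRegion.integrable_withUniformIndex hT fun t ht => hrun.integrable_lambdaMin hp ht,
    hrun.neg_rate_le_integral_lambdaMin hn hp ha hgap haT hTb⟩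

theorem mainTheorem7
    (L₀ L₁ G₀ G₁ δ M₀ M₁ K₀ K₁ C₀ C₁ D a b : ℝ)
    (hL₀ : 0 < L₀) (hL₁ : 0 ≤ L₁) (hG₀ : 0 ≤ G₀) (hG₁ : 0 ≤ G₁)
    (hδ : 0 < δ) (hM₀ : 0 < M₀) (hM₁ : 0 ≤ M₁) (hK₀ : 0 ≤ K₀) (hK₁ : 0 ≤ K₁)
    (hC₀ : 0 < C₀) (hC₁ : 0 < C₁) (ha : 0 < a) :
    ∃ C : ℝ, 0 < C ∧
      ∀ (n k : ℕ) (_ : 2 ≤ n)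
        (Ξ : Type*) [MeasurableSpace Ξ] (P : Measure Ξ) [IsProbabilityMeasure P]
        (f : TrustRegion.Vec n → Ξ → ℝ) (_ : Measurable (Function.uncurry f))
        (_ : ∀ x, Integrable (f x) P)
        (_ : ∀ ξ, TrustRegion.TwiceDifferentiable (fun x => f x ξ))
        (x₀ : TrustRegion.Vec n)
        (_ : BddBelow (Set.range (TrustRegion.objective P f)))
        (_ : TrustRegion.objective P f x₀ - ⨅ x, TrustRegion.objective P f x ≤ D)
        (_ : TrustRegion.GeneralizedSmooth (TrustRegion.objective P f) L₀ L₁)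
        (_ : TrustRegion.BoundedGradientVariance P f G₀ G₁)
        (_ : TrustRegion.SecondOrderSmooth (TrustRegion.objective P f) δ M₀ M₁)
        (_ : TrustRegion.BoundedHessianVariance P f K₀ K₁)
        (ε : ℝ) (_ : 0 < ε) (_ : ε < 3 / (5 * M₁ + 18 * G₁ + 24 * K₁ + 6 * C₁))
        (_ : L₁ ^ 2 * ε < 1)
        (T : ℕ) (_ : a * ε ^ (-(3 / 2) : ℝ) ≤ T) (_ : (T : ℝ) ≤ b * ε ^ (-(3 / 2) : ℝ))
        (m₁ m₂ : ℕ) (_ : m₁ = ⌈ε ^ (-2 : ℝ)⌉₊) (_ : m₂ = ⌈22 * Real.log n * ε⁻¹⌉₊)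
        (Ω : Type*) [mΩ : MeasurableSpace Ω] (μ : Measure Ω) [IsProbabilityMeasure μ]
        (ℱ : Filtration ℕ mΩ)
        (S₁ : ℕ → Fin m₁ → Ω → Ξ) (S₂ : ℕ → Fin m₂ → Ω → Ξ)
        (V : ℕ → Ω → Matrix (Fin n) (Fin k) ℝ) (x d : ℕ → Ω → TrustRegion.Vec n)
        (_ : TrustRegion.IsRun P f μ ℱ x₀ (Real.sqrt ε) T m₁ m₂ S₁ S₂ V x d)
        (_ : TrustRegion.SubspaceInexactness (TrustRegion.objective P f) μ T V x d C₀ C₁),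
        (Integrable (fun p : ℕ × Ω => ‖gradient (TrustRegion.objective P f) (x (p.1 + 1) p.2)‖)
            (TrustRegion.withUniformIndex T μ) ∧
          ∫ p : ℕ × Ω, ‖gradient (TrustRegion.objective P f) (x (p.1 + 1) p.2)‖
            ∂(TrustRegion.withUniformIndex T μ) ≤ C * ε) ∧
        (Integrable (fun p : ℕ × Ω => TrustRegion.lambdaMin (TrustRegion.projected (V p.1 p.2)
              (TrustRegion.hess (TrustRegion.objective P f) (x (p.1 + 1) p.2))))
            (TrustRegion.withUniformIndex T μ) ∧
          -(C * Real.sqrt ε) ≤ ∫ p : ℕ × Ω, TrustRegion.lambdaMin (TrustRegion.projected (V p.1 p.2)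
              (TrustRegion.hess (TrustRegion.objective P f) (x (p.1 + 1) p.2)))
            ∂(TrustRegion.withUniformIndex T μ)) := by
  let c : TrustRegion.Constants :=
    ⟨L₀, L₁, G₀, G₁, δ, M₀, M₁, K₀, K₁, C₀, C₁, hL₀, hL₁, hG₀, hG₁, hδ, hM₀.le, hM₁, hK₀, hK₁,
      hC₀.le, hC₁.le⟩
  obtain ⟨C, hC, h⟩ := mainTheorem7_general c D b ha
  refine ⟨C, hC, ?_⟩
  intro n k hn Ξ _ P _ f hf hint hf₂ x₀ hbdd hD hF hg hF₂ hh ε hε _ hεL₁ T haT hTb m₁ m₂ hm₁ hm₂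
    Ω _ μ _ ℱ S₁ S₂ V x d hrun hV
  exact h n k hn Ξ P f ⟨hf, hint, hf₂, hF, hF₂, hg, hh⟩ x₀ hbdd hD ε hε hεL₁.le T haT hTb m₁ m₂
    (hm₁ ▸ Nat.le_ceil _) (hm₂ ▸ Nat.le_ceil _) Ω μ ℱ S₁ S₂ V x d hrun hV
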